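/- Let $\mathbb K$ be a field and $R=\mathbb K[x_1,\dots,x_n]$. For a monomial ideal $I$ of $R$ let $\mathcal G(I)$ be its unique minimal set of monomial generators, and let $\beta_{i,j}(I)$ be its graded Betti numbers, that is, the number of summands $R(-j)$ in homological degree $i$ of a minimal graded free resolution of $I$ over $R$ (with $\beta_{i,j}(I)=0$ for $i<0$). For a monomial $u=x_1^{a_1}\cdots x_n^{a_n}$ put $\operatorname{supp}(u)=\{x_i : a_i\neq 0\}$, and for a monomial $M$ write $[u,M]=1$ if $x_i^{a_i}\nmid M$ for all $x_i\in\operatorname{supp}(u)$, and $[u,M]\neq 1$ otherwise. Set $$I^u=(M\in\mathcal G(I) : [u,M]\neq 1),\qquad I_u=(M\in\mathcal G(I) : [u,M]=1).$$ The monomial $u$ is called a shedding monomial for $I$ if $I_u\neq 0$ and for each $M\in\mathcal G(I_u)$ and each $x_\ell\in\operatorname{supp}(u)$ there is $N\in\mathcal G(I^u)$ with $(N):(M)=(x_\ell)$. For an integer $k$, the monomial ideal $I$ is called $k$-decomposable (recursively) if $|\mathcal G(I)|=1$, or else if it has a shedding monomial $u$ with $|\operatorname{supp}(u)|\le k+1$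 such that $I_u$ and $I^u$ are $k$-decomposable. **Theorem.** Let $I$ be a $k$-decomposable monomial ideal with the shedding monomial $u$, that is, $u$ is a shedding monomial for $I$ with $|\operatorname{supp}(u)|\le k+1$ such that $I_u$ and $I^u$ are $k$-decomposable. Let $m=|\operatorname{supp}(u)|$. Then for all integers $i,j$, $$\beta_{i,j}(I)=\beta_{i,j}(I^u)+\sum_{l=0}^{m}\binom{m}{l}\,\beta_{i-l,\,j-l}(I_u).$$ -/

import Mathlib

/-! Monomials of `K[x_1, …, x_n]` are written as exponent vectors `Fin n →₀ ℕ`;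
`monomial a 1` is the monomial with exponent vector `a`. -/

open MvPolynomial

namespace DecomposableIdeal

section Monomials

variable {n : ℕ} {K : Type*} [Field K]

/-- An ideal of `K[x_1, …, x_n]` generated by monomials. -/
def IsMonomialIdeal (I : Ideal (MvPolynomial (Fin n) K)) : Prop :=
  ∃ s : Set (Fin n →₀ ℕ), I = Ideal.span ((fun a => monomial a (1 : K)) '' s)

/-- `𝒢(I)`: the monomials of `I` that are minimal with respect to divisibility. -/
def minGens (I : Ideal (MvPolynomial (Fin n) K)) : Set (Fin n →₀ ℕ) :=
  {a | Minimal (fun b => monomial b (1 : K) ∈ I) a}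

/-- `[u, M] = 1`: for every variable `x_l` in the support of `u`, the power of `x_l` occurring
in `u` does not divide `M`. -/
def BracketEqOne (u M : Fin n →₀ ℕ) : Prop :=
  ∀ l ∈ u.support, ¬ u l ≤ M l

/-- `I^u`, generated by the minimal generators `M` of `I` with `[u, M] ≠ 1`. -/
noncomputable def upperPart (I : Ideal (MvPolynomial (Fin n) K)) (u : Fin n →₀ ℕ) :
    Ideal (MvPolynomial (Fin n) K) :=
  Ideal.span ((fun a => monomial a (1 : K)) '' {M | M ∈ minGens I ∧ ¬ BracketEqOne u M})

/-- `I_u`, generated by the minimal generators `M` of `I` with `[u, M] = 1`. -/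
noncomputable def lowerPart (I : Ideal (MvPolynomial (Fin n) K)) (u : Fin n →₀ ℕ) :
    Ideal (MvPolynomial (Fin n) K) :=
  Ideal.span ((fun a => monomial a (1 : K)) '' {M | M ∈ minGens I ∧ BracketEqOne u M})

/-- `u` is a shedding monomial for `I`. The truncated difference `N - M` of exponent vectors is
the exponent vector of `N / gcd (N, M)`, the generator of the colon ideal `(N) : (M)`. -/
def IsSheddingMonomial (I : Ideal (MvPolynomial (Fin n) K)) (u : Fin n →₀ ℕ) : Prop :=
  lowerPart I u ≠ ⊥ ∧
    ∀ M ∈ minGens (lowerPart I u), ∀ l ∈ u.support,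
      ∃ N ∈ minGens (upperPart I u), N - M = Finsupp.single l 1

/-- `k`-decomposable monomial ideals: those with exactly one minimal generator, and those with
a shedding monomial `u` with `|supp u| ≤ k + 1` such that `I_u` and `I^u` are `k`-decomposable. -/
inductive IsKDecomposable (k : ℤ) : Ideal (MvPolynomial (Fin n) K) → Prop
  | principal (I : Ideal (MvPolynomial (Fin n) K)) (hI : IsMonomialIdeal I)
      (h : ∃ M, minGens I = {M}) : IsKDecomposable k I
  | shedding (I : Ideal (MvPolynomial (Fin n) K)) (hI : IsMonomialIdeal I) (u : Fin n →₀ ℕ)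
      (hu : IsSheddingMonomial I u) (hk : (u.support.card : ℤ) ≤ k + 1)
      (hlow : IsKDecomposable k (lowerPart I u)) (hup : IsKDecomposable k (upperPart I u)) :
      IsKDecomposable k I

/-- `I` is `k`-decomposable *with the shedding monomial `u`*: the monomial `u` is one that
witnesses the `k`-decomposability of `I`. -/
def IsKDecomposableWith (k : ℤ) (I : Ideal (MvPolynomial (Fin n) K)) (u : Fin n →₀ ℕ) : Prop :=
  IsMonomialIdeal I ∧ IsSheddingMonomial I u ∧ (u.support.card : ℤ) ≤ k + 1 ∧
    IsKDecomposable k (lowerPart I u) ∧ IsKDecomposable k (upperPart I u)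

theorem IsKDecomposableWith.isKDecomposable {k : ℤ} {I : Ideal (MvPolynomial (Fin n) K)}
    {u : Fin n →₀ ℕ} (h : IsKDecomposableWith k I u) : IsKDecomposable k I :=
  .shedding I h.1 u h.2.1 h.2.2.1 h.2.2.2.1 h.2.2.2.2

/-- All terms of `p` have degree `d`. -/
def IsHomogeneousOfDegree (d : ℤ) (p : MvPolynomial (Fin n) K) : Prop :=
  ∀ e ∈ p.support, (e.degree : ℤ) = d

end Monomials

/-- A minimal graded free resolution
`⋯ → F_2 → F_1 → F_0 → I → 0` over `R = K[x_1, …, x_n]`, where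
`F_i = ⨁_a R(-deg i a)` has `rank i` basis elements, the `a`-th one in degree `deg i a`. -/
structure MinimalGradedFreeResolution {n : ℕ} {K : Type*} [Field K]
    (I : Ideal (MvPolynomial (Fin n) K)) where
  rank : ℕ → ℕ
  deg : ∀ i, Fin (rank i) → ℤ
  /-- the differential `F_{i+1} → F_i` -/
  d : ∀ i, (Fin (rank (i + 1)) → MvPolynomial (Fin n) K) →ₗ[MvPolynomial (Fin n) K]
    (Fin (rank i) → MvPolynomial (Fin n) K)
  /-- the augmentation `F_0 → I ⊆ R` -/
  aug : (Fin (rank 0) → MvPolynomial (Fin n) K) →ₗ[MvPolynomial (Fin n) K] MvPolynomial (Fin n) K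
  /-- the differentials preserve degrees -/
  d_homogeneous : ∀ i a b, IsHomogeneousOfDegree (deg (i + 1) a - deg i b) (d i (Pi.single a 1) b)
  /-- the augmentation preserves degrees -/
  aug_homogeneous : ∀ a, IsHomogeneousOfDegree (deg 0 a) (aug (Pi.single a 1))
  /-- exactness at `I`, at `F_0`, and at `F_{i+1}` -/
  range_aug : LinearMap.range aug = I
  ker_aug : LinearMap.ker aug = LinearMap.range (d 0)
  ker_d : ∀ i, LinearMap.ker (d i) = LinearMap.range (d (i + 1))
  /-- minimality: the image of `F_{i+1}` lies in `(x_1, …, x_n) F_i` -/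
  minimal : ∀ i v b, d i v b ∈ idealOfVars (Fin n) K

/-- The number of basis elements of degree `j` in `F_i`, that is, the number of summands `R(-j)`
of `F_i`. -/
def MinimalGradedFreeResolution.numGens {n : ℕ} {K : Type*} [Field K]
    {I : Ideal (MvPolynomial (Fin n) K)} (F : MinimalGradedFreeResolution I) (i : ℕ) (j : ℤ) : ℕ :=
  (Finset.univ.filter fun a : Fin (F.rank i) => F.deg i a = j).card

open Classical in
/-- The graded Betti number `β_{i,j}(I)`: the number of summands `R(-j)` in homological degree `i`
of a minimal graded free resolution of `I`; it is `0` for `i < 0`. A resolution exists for every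
monomial ideal by `nonempty_minimalGradedFreeResolution` below (the other value is only there
because the definition is written for all ideals). -/
noncomputable def gradedBetti {n : ℕ} {K : Type*} [Field K]
    (I : Ideal (MvPolynomial (Fin n) K)) (i j : ℤ) : ℕ :=
  if h : Nonempty (MinimalGradedFreeResolution I) then
    if 0 ≤ i then h.some.numGens i.toNat j else 0
  else 0

/-! ### Existence of minimal graded free resolutions of monomial ideals -/

section Existence

variable {n : ℕ} {K : Type*} [Field K]

/-- The part of degree `k` of a polynomial, for an integer `k`. -/
noncomputable def part (k : ℤ) : MvPolynomial (Fin n) K →ₗ[K] MvPolynomial (Fin n) K :=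
  if 0 ≤ k then homogeneousComponent k.toNat else 0

theorem coeff_part (k : ℤ) (p : MvPolynomial (Fin n) K) (e : Fin n →₀ ℕ) :
    coeff e (part k p) = if (e.degree : ℤ) = k then coeff e p else 0 := by
  unfold part
  split_ifs with h1 h2 h2
  · rw [coeff_homogeneousComponent, if_pos (by omega)]
  · rw [coeff_homogeneousComponent, if_neg (by omega)]
  · omega
  · simp

theorem part_of_homogeneous {d : ℤ} {p : MvPolynomial (Fin n) K} (hp : IsHomogeneousOfDegree d p)
    (k : ℤ) : part k p = if k = d then p else 0 := by
  ext e
  rw [coeff_part]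
  by_cases he : coeff e p = 0
  · split_ifs <;> simp [he]
  · have := hp e (mem_support_iff.mpr he)
    split_ifs <;> first | rfl | omega

theorem part_homogeneous (k : ℤ) (p : MvPolynomial (Fin n) K) :
    IsHomogeneousOfDegree k (part k p) := by
  intro e he
  rw [mem_support_iff, coeff_part] at he
  by_contra h
  simp [h] at he

theorem homogeneous_mul {d d' : ℤ} {p q : MvPolynomial (Fin n) K}
    (hp : IsHomogeneousOfDegree d p) (hq : IsHomogeneousOfDegree d' q) :
    IsHomogeneousOfDegree (d + d') (p * q) := by
  classical
  intro e he
  obtain ⟨a, ha, b, hb, rfl⟩ := Finset.mem_add.mp (support_mul p q he)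
  have h1 := hp a ha
  have h2 := hq b hb
  rw [map_add]
  push_cast
  omega

theorem part_mul {d : ℤ} {q : MvPolynomial (Fin n) K} (hq : IsHomogeneousOfDegree d q) (k : ℤ)
    (p : MvPolynomial (Fin n) K) : part k (p * q) = part (k - d) p * q := by
  induction p using MvPolynomial.induction_on' with
  | add p p' hp hp' => rw [add_mul, map_add, map_add, add_mul, hp, hp']
  | monomial a b =>
    have hm : IsHomogeneousOfDegree (a.degree : ℤ) (monomial a b : MvPolynomial (Fin n) K) := by
      intro e he
      have := support_monomial_subset he
      simp at this
      simp [this]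
    rw [part_of_homogeneous (homogeneous_mul hm hq), part_of_homogeneous hm]
    by_cases h : k - d = a.degree
    · rw [if_pos h, if_pos (by omega)]
    · rw [if_neg h, if_neg (by omega), zero_mul]

/-- The part of degree `j` of an element of `⨁_b R(-deg b)`. -/
noncomputable def vecPart {r : ℕ} (deg : Fin r → ℤ) (j : ℤ)
    (v : Fin r → MvPolynomial (Fin n) K) : Fin r → MvPolynomial (Fin n) K :=
  fun b => part (j - deg b) (v b)

/-- A homogeneous element of degree `j` of `⨁_b R(-deg b)`. -/
def IsHomVec {r : ℕ} (deg : Fin r → ℤ) (j : ℤ) (v : Fin r → MvPolynomial (Fin n) K) : Prop :=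
  ∀ b, IsHomogeneousOfDegree (j - deg b) (v b)

/-- A graded submodule of `⨁_b R(-deg b)`. -/
def IsGradedSub {r : ℕ} (deg : Fin r → ℤ)
    (N : Submodule (MvPolynomial (Fin n) K) (Fin r → MvPolynomial (Fin n) K)) : Prop :=
  ∀ v ∈ N, ∀ j, vecPart deg j v ∈ N

theorem mem_span_parts {r : ℕ} (deg : Fin r → ℤ) (v : Fin r → MvPolynomial (Fin n) K) :
    v ∈ Submodule.span (MvPolynomial (Fin n) K) (Set.range fun j => vecPart deg j v) := by
  classical
  let T : Finset ℤ := Finset.univ.biUnion fun b : Fin r =>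
    (v b).support.image fun e => (e.degree : ℤ) + deg b
  have hv : v = ∑ j ∈ T, vecPart deg j v := by
    funext b
    ext e
    rw [Finset.sum_apply, coeff_sum]
    simp only [vecPart, coeff_part]
    rw [Finset.sum_eq_single ((e.degree : ℤ) + deg b)]
    · simp
    · intro j _ hj
      rw [if_neg (by omega)]
    · intro hT
      by_contra hne
      refine hT (Finset.mem_biUnion.mpr ⟨b, Finset.mem_univ _, Finset.mem_image.mpr ⟨e, ?_, rfl⟩⟩)
      rw [mem_support_iff]
      intro h0
      simp [h0] at hne
  rw [hv]
  refine Submodule.sum_mem _ fun j _ => ?_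
  rw [← hv]
  exact Submodule.subset_span ⟨j, rfl⟩

theorem exists_homogeneous_generators {r : ℕ} (deg : Fin r → ℤ)
    (N : Submodule (MvPolynomial (Fin n) K) (Fin r → MvPolynomial (Fin n) K))
    (hN : IsGradedSub deg N) :
    ∃ (s : ℕ) (w : Fin s → Fin r → MvPolynomial (Fin n) K) (deg' : Fin s → ℤ),
      (∀ a, IsHomVec deg (deg' a) (w a)) ∧
        Submodule.span (MvPolynomial (Fin n) K) (Set.range w) = N := by
  classical
  let H : Set (Fin r → MvPolynomial (Fin n) K) := {v | v ∈ N ∧ ∃ j, IsHomVec deg j v}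
  have hH : Submodule.span (MvPolynomial (Fin n) K) H = N := by
    apply le_antisymm
    · exact Submodule.span_le.mpr fun v hv => hv.1
    · intro v hv
      refine Submodule.span_mono ?_ (mem_span_parts deg v)
      rintro _ ⟨j, rfl⟩
      exact ⟨hN v hv j, j, fun b => part_homogeneous _ _⟩
  have hfg : (Submodule.span (MvPolynomial (Fin n) K) H).FG := IsNoetherian.noetherian _
  obtain ⟨t, htH, ht⟩ := Submodule.fg_span_iff_fg_span_finset_subset H |>.mp hfg
  have hmem : ∀ a : Fin t.card, ((t.equivFin.symm a : t) : Fin r → MvPolynomial (Fin n) K) ∈ H :=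
    fun a => htH (t.equivFin.symm a).2
  choose deg' hdeg' using fun a => (hmem a).2
  refine ⟨t.card, fun a => (t.equivFin.symm a : t), deg', hdeg', ?_⟩
  rw [← hH, ht]
  congr 1
  ext v
  constructor
  · rintro ⟨a, rfl⟩
    exact (t.equivFin.symm a).2
  · intro hv
    exact ⟨t.equivFin ⟨v, hv⟩, by simp⟩

theorem mem_idealOfVars_of_constantCoeff {p : MvPolynomial (Fin n) K}
    (hp : coeff 0 p = 0) : p ∈ idealOfVars (Fin n) K := by
  have : idealOfVars (Fin n) K
      = Ideal.span ((X : Fin n → MvPolynomial (Fin n) K) '' Set.univ) := by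
    rw [Set.image_univ]
  rw [this, mem_ideal_span_X_image]
  intro m hm
  by_contra! h
  have : m = 0 := by
    ext i
    exact h i (Set.mem_univ i)
  rw [mem_support_iff, this] at hm
  exact hm hp

theorem exists_minimal_cover {r : ℕ} (deg : Fin r → ℤ)
    (N : Submodule (MvPolynomial (Fin n) K) (Fin r → MvPolynomial (Fin n) K))
    (hN : IsGradedSub deg N) :
    ∃ (s : ℕ) (deg' : Fin s → ℤ)
      (f : (Fin s → MvPolynomial (Fin n) K) →ₗ[MvPolynomial (Fin n) K]
        (Fin r → MvPolynomial (Fin n) K)),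
      (∀ a, IsHomVec deg (deg' a) (f (Pi.single a 1))) ∧ LinearMap.range f = N ∧
        IsGradedSub deg' (LinearMap.ker f) ∧
        ∀ c ∈ LinearMap.ker f, ∀ a, c a ∈ idealOfVars (Fin n) K := by
  classical
  have hex := exists_homogeneous_generators deg N hN
  obtain ⟨w, deg', hw, hspan⟩ := Nat.find_spec hex
  have hmin := fun m hm => Nat.find_min hex (m := m) hm
  generalize Nat.find hex = s at *
  let f := Fintype.linearCombination (MvPolynomial (Fin n) K) w
  have hf : ∀ c b, f c b = ∑ a, c a * w a b := by
    intro c b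
    simp [f, Fintype.linearCombination_apply, Finset.sum_apply]
  have hker : IsGradedSub deg' (LinearMap.ker f) := by
    intro c hc j
    rw [LinearMap.mem_ker] at hc ⊢
    funext b
    have h0 : part (j - deg b) (f c b) = 0 := by
      rw [hc]
      simp
    rw [hf, map_sum] at h0
    rw [hf, Pi.zero_apply, ← h0]
    refine Finset.sum_congr rfl fun a _ => ?_
    rw [part_mul (hw a b)]
    simp only [vecPart]
    congr 2
    ring_nf
  refine ⟨s, deg', f, ?_, ?_, hker, ?_⟩
  · intro a
    have : f (Pi.single a 1) = w a := by
      simp [f, Fintype.linearCombination_apply_single]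
    rw [this]
    exact hw a
  · rw [← hspan, Fintype.range_linearCombination]
  · intro c hc a₀
    refine mem_idealOfVars_of_constantCoeff ?_
    by_contra hne
    cases s with
    | zero => exact a₀.elim0
    | succ s =>
    have hcp := hker c hc (deg' a₀)
    rw [LinearMap.mem_ker] at hcp
    have hC : vecPart deg' (deg' a₀) c a₀ = C (coeff 0 (c a₀)) := by
      ext e
      simp only [vecPart, coeff_part, sub_self, coeff_C]
      by_cases he : e = 0
      · simp [he]
      · have h1 : e.degree ≠ 0 := by
          rwa [Ne, Finsupp.degree_eq_zero_iff]
        rw [if_neg (by exact_mod_cast h1), if_neg (Ne.symm he)]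
    have hsum : ∑ a, vecPart deg' (deg' a₀) c a • w a = 0 := hcp
    rw [Fin.sum_univ_succAbove _ a₀, hC] at hsum
    have hmem : w a₀ ∈ Submodule.span (MvPolynomial (Fin n) K)
        (Set.range fun a => w (a₀.succAbove a)) := by
      have h2 : w a₀ = (C (-(coeff 0 (c a₀))⁻¹) : MvPolynomial (Fin n) K) •
          ∑ a, vecPart deg' (deg' a₀) c (a₀.succAbove a) • w (a₀.succAbove a) := by
        have h3 := eq_neg_of_add_eq_zero_right hsum
        rw [h3, smul_neg, ← neg_smul, ← C_neg, neg_neg, smul_smul, ← C_mul,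
          inv_mul_cancel₀ hne, C_1, one_smul]
      rw [h2]
      refine Submodule.smul_mem _ _ (Submodule.sum_mem _ fun a _ => ?_)
      exact Submodule.smul_mem _ _ (Submodule.subset_span ⟨a, rfl⟩)
    refine hmin s (Nat.lt_succ_self s) ⟨fun a => w (a₀.succAbove a),
      fun a => deg' (a₀.succAbove a), fun a => hw _, ?_⟩
    rw [← hspan]
    apply le_antisymm
    · refine Submodule.span_mono ?_
      rintro _ ⟨a, rfl⟩
      exact ⟨_, rfl⟩
    · rw [Submodule.span_le]
      rintro _ ⟨a, rfl⟩
      rcases Fin.eq_self_or_eq_succAbove a₀ a with rfl | ⟨b, rfl⟩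
      · exact hmem
      · exact Submodule.subset_span ⟨b, rfl⟩

/-- A graded submodule of a graded free module. -/
structure Stage (n : ℕ) (K : Type*) [Field K] where
  r : ℕ
  deg : Fin r → ℤ
  N : Submodule (MvPolynomial (Fin n) K) (Fin r → MvPolynomial (Fin n) K)
  graded : IsGradedSub deg N

theorem Stage.exists_next (A : Stage n K) :
    ∃ (B : Stage n K) (f : (Fin B.r → MvPolynomial (Fin n) K) →ₗ[MvPolynomial (Fin n) K]
        (Fin A.r → MvPolynomial (Fin n) K)),
      (∀ a, IsHomVec A.deg (B.deg a) (f (Pi.single a 1))) ∧ LinearMap.range f = A.N ∧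
        LinearMap.ker f = B.N ∧ ∀ c ∈ B.N, ∀ a, c a ∈ idealOfVars (Fin n) K := by
  obtain ⟨s, deg', f, h1, h2, h3, h4⟩ := exists_minimal_cover A.deg A.N A.graded
  exact ⟨⟨s, deg', LinearMap.ker f, h3⟩, f, h1, h2, rfl, h4⟩

theorem nonempty_of_graded (I : Ideal (MvPolynomial (Fin n) K))
    (hI : ∀ p ∈ I, ∀ k, part k p ∈ I) : Nonempty (MinimalGradedFreeResolution I) := by
  choose next f h1 h2 h3 h4 using Stage.exists_next (n := n) (K := K)
  let π : (Fin 1 → MvPolynomial (Fin n) K) →ₗ[MvPolynomial (Fin n) K] MvPolynomial (Fin n) K :=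
    LinearMap.proj 0
  have hπ : Function.Surjective π := LinearMap.proj_surjective 0
  let A : Stage n K :=
    { r := 1
      deg := fun _ => 0
      N := Submodule.comap π I
      graded := by
        intro v hv j
        simp only [Submodule.mem_comap] at hv ⊢
        have := hI _ hv (j - 0)
        exact this }
  let st : ℕ → Stage n K := fun i => Nat.rec A (fun _ B => next B) i
  refine ⟨{
    rank := fun i => (st (i + 1)).r
    deg := fun i => (st (i + 1)).deg
    d := fun i => f (st (i + 1))
    aug := π.comp (f A)
    d_homogeneous := fun i a b => h1 (st (i + 1)) a b
    aug_homogeneous := ?_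
    range_aug := ?_
    ker_aug := ?_
    ker_d := ?_
    minimal := ?_ }⟩
  · intro a
    have := h1 A a 0
    simp only [A, sub_zero] at this
    exact this
  · rw [LinearMap.range_comp, h2 A]
    exact Submodule.map_comap_eq_of_surjective hπ I
  · have : LinearMap.ker (π.comp (f A)) = LinearMap.ker (f A) := by
      ext c
      simp only [LinearMap.mem_ker, LinearMap.comp_apply]
      constructor
      · intro h
        funext b
        rw [Subsingleton.elim (α := Fin 1) b 0]
        exact h
      · intro h
        rw [h]
        rfl
    rw [this, h3 A]
    exact (h2 (st 1)).symm
  · intro i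
    rw [h3]
    exact (h2 (st (i + 2))).symm
  · intro i v b
    refine h4 (st i) _ ?_ b
    have : f (st (i + 1)) v ∈ LinearMap.range (f (st (i + 1))) := ⟨v, rfl⟩
    rw [h2] at this
    exact this

/-- Every monomial ideal has a minimal graded free resolution. -/
theorem nonempty_minimalGradedFreeResolution {I : Ideal (MvPolynomial (Fin n) K)}
    (hI : IsMonomialIdeal I) : Nonempty (MinimalGradedFreeResolution I) := by
  obtain ⟨s, rfl⟩ := hI
  refine nonempty_of_graded _ fun p hp k => ?_
  rw [mem_ideal_span_monomial_image] at hp ⊢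
  intro e he
  refine hp e ?_
  rw [mem_support_iff, coeff_part] at he
  rw [mem_support_iff]
  intro h
  simp [h] at he

end Existence

end DecomposableIdeal

/-!
Decomposable monomial ideals have linear quotients, and the formula is read off from the Betti
numbers of ideals with linear quotients.

Suppose that the minimal generators of a monomial ideal can be ordered such that for each `M` the
preceding generators have a colon ideal `(x_l : l ∈ S M)` with respect to `M`. Then
`β_{i,j} = ∑_M C(|S M|, i)`, summed over the `M` of degree `j - i`
(`HasLinearQuotients.gradedBetti_eq`). Indeed, an order with this property can be replaced by one in
which the degrees increase, with the same sets `S M` (`HasLinearQuotients.sort`). Adding the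
generators in this order, each step is a mapping cone with the Koszul complex of the variables in
`S M` (`exists_resolution_cone`). For degree reasons the comparison map has no constant entries,
so that the cone is again minimal. The Koszul complex arises in the same way, by adding one
variable at a time. As `gradedBetti` is defined by some minimal resolution, it is also needed that
two minimal resolutions have the same numbers of generators
(`MinimalGradedFreeResolution.numGens_eq`).

If `u` is a shedding monomial, put the generators of `I^u` before those of `I_u`, each in an order
with linear quotients. This is an order with linear quotients for `I`: the sets of the generators of
`I^u` do not change, and those of the generators of `I_u` grow by the support of `u`
(`HasLinearQuotients.union`). The enlargement is disjoint, as the shedding condition forces each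
generator of `I_u` to have exponent `u_l - 1` at every `x_l` in the support of `u`. Hence
`C(|S M|, i)` becomes `C(|S M| + m, i)`, and Vandermonde's identity gives the sum over `l`.
-/

namespace DecomposableIdeal

open MvPolynomial

/-! ### Homogeneous maps and uniqueness of minimal resolutions -/

section HomogeneousMaps

variable {n : ℕ} {K : Type*} [Field K]

theorem homogeneous_zero (d : ℤ) : IsHomogeneousOfDegree d (0 : MvPolynomial (Fin n) K) := by
  intro e he
  simp at he

theorem homogeneous_one : IsHomogeneousOfDegree 0 (1 : MvPolynomial (Fin n) K) := by
  classical
  intro e he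
  rw [mem_support_iff, coeff_one] at he
  have h : e = 0 := by
    by_contra h
    exact he (if_neg (Ne.symm h))
  simp [h]

theorem homogeneous_add {d : ℤ} {p q : MvPolynomial (Fin n) K}
    (hp : IsHomogeneousOfDegree d p) (hq : IsHomogeneousOfDegree d q) :
    IsHomogeneousOfDegree d (p + q) := by
  classical
  intro e he
  rcases Finset.mem_union.mp (support_add he) with h | h
  exacts [hp e h, hq e h]

theorem homogeneous_neg {d : ℤ} {p : MvPolynomial (Fin n) K}
    (hp : IsHomogeneousOfDegree d p) : IsHomogeneousOfDegree d (-p) := by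
  intro e he
  rw [support_neg] at he
  exact hp e he

theorem homogeneous_sum {ι : Type*} {s : Finset ι} {d : ℤ} {p : ι → MvPolynomial (Fin n) K}
    (hp : ∀ a ∈ s, IsHomogeneousOfDegree d (p a)) : IsHomogeneousOfDegree d (∑ a ∈ s, p a) := by
  classical
  induction s using Finset.induction_on with
  | empty => simpa using homogeneous_zero d
  | insert a s ha ih =>
    rw [Finset.sum_insert ha]
    exact homogeneous_add (hp a (Finset.mem_insert_self a s))
      (ih fun b hb => hp b (Finset.mem_insert_of_mem hb))

theorem homogeneous_prod {ι : Type*} {s : Finset ι} {d : ι → ℤ} {p : ι → MvPolynomial (Fin n) K}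
    (hp : ∀ a ∈ s, IsHomogeneousOfDegree (d a) (p a)) :
    IsHomogeneousOfDegree (∑ a ∈ s, d a) (∏ a ∈ s, p a) := by
  classical
  induction s using Finset.induction_on with
  | empty => simpa using homogeneous_one
  | insert a s ha ih =>
    rw [Finset.sum_insert ha, Finset.prod_insert ha]
    exact homogeneous_mul (hp a (Finset.mem_insert_self a s))
      (ih fun b hb => hp b (Finset.mem_insert_of_mem hb))

theorem homogeneous_monomial (e : Fin n →₀ ℕ) (c : K) :
    IsHomogeneousOfDegree (e.degree : ℤ) (monomial e c : MvPolynomial (Fin n) K) := by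
  intro e' he
  have := support_monomial_subset he
  rw [Finset.mem_singleton] at this
  rw [this]

theorem coeff_zero_of_homogeneous {d : ℤ} (hd : d ≠ 0) {p : MvPolynomial (Fin n) K}
    (hp : IsHomogeneousOfDegree d p) : coeff 0 p = 0 := by
  by_contra h
  have := hp 0 (mem_support_iff.mpr h)
  simp at this
  exact hd this.symm

theorem constantCoeff_eq_zero_of_mem {p : MvPolynomial (Fin n) K}
    (hp : p ∈ idealOfVars (Fin n) K) : constantCoeff p = 0 := by
  have : idealOfVars (Fin n) K ≤ RingHom.ker (constantCoeff (σ := Fin n) (R := K)) := by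
    refine Ideal.span_le.mpr ?_
    rintro _ ⟨i, rfl⟩
    simp
  exact this hp

/-- A linear map `⨁_a R(-deg a) → ⨁_b R(-deg' b)` that preserves degrees. -/
def IsHomMap {ι κ : Type*} [DecidableEq ι] (deg : ι → ℤ) (deg' : κ → ℤ)
    (f : (ι → MvPolynomial (Fin n) K) →ₗ[MvPolynomial (Fin n) K] (κ → MvPolynomial (Fin n) K)) :
    Prop :=
  ∀ a b, IsHomogeneousOfDegree (deg a - deg' b) (f (Pi.single a 1) b)

theorem linearMap_apply_eq_sum {ι κ : Type*} [Fintype ι] [DecidableEq ι]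
    (f : (ι → MvPolynomial (Fin n) K) →ₗ[MvPolynomial (Fin n) K] (κ → MvPolynomial (Fin n) K))
    (v : ι → MvPolynomial (Fin n) K) (b : κ) : f v b = ∑ a, v a * f (Pi.single a 1) b := by
  rw [LinearMap.pi_apply_eq_sum_univ f v, Finset.sum_apply]
  refine Finset.sum_congr rfl fun a _ => ?_
  rw [Pi.smul_apply, smul_eq_mul]
  have h : (fun i => if a = i then (1 : MvPolynomial (Fin n) K) else 0) = Pi.single a 1 := by
    funext i
    simp [Pi.single_apply, eq_comm]
  rw [h]

theorem IsHomMap.comp {ι κ τ : Type*} [DecidableEq ι] [Fintype κ] [DecidableEq κ] {deg : ι → ℤ}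
    {deg' : κ → ℤ} {deg'' : τ → ℤ}
    {f : (ι → MvPolynomial (Fin n) K) →ₗ[MvPolynomial (Fin n) K] (κ → MvPolynomial (Fin n) K)}
    {g : (κ → MvPolynomial (Fin n) K) →ₗ[MvPolynomial (Fin n) K] (τ → MvPolynomial (Fin n) K)}
    (hg : IsHomMap deg' deg'' g) (hf : IsHomMap deg deg' f) : IsHomMap deg deg'' (g ∘ₗ f) := by
  intro a b
  rw [LinearMap.comp_apply, linearMap_apply_eq_sum]
  refine homogeneous_sum fun c _ => ?_
  have := homogeneous_mul (hf a c) (hg c b)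
  rwa [sub_add_sub_cancel] at this

variable {ι κ τ : Type*} [Fintype ι] [DecidableEq ι]

/-- Free graded modules are projective among graded modules, with lifts of degree `0`. -/
theorem IsHomMap.exists_lift [Fintype κ] [DecidableEq κ]
    {deg : ι → ℤ} {deg' : κ → ℤ} {deg'' : τ → ℤ}
    {f : (ι → MvPolynomial (Fin n) K) →ₗ[MvPolynomial (Fin n) K] (τ → MvPolynomial (Fin n) K)}
    {g : (κ → MvPolynomial (Fin n) K) →ₗ[MvPolynomial (Fin n) K] (τ → MvPolynomial (Fin n) K)}
    (hf : IsHomMap deg deg'' f) (hg : IsHomMap deg' deg'' g)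
    (h : ∀ v, g v ∈ LinearMap.range f) :
    ∃ A : (κ → MvPolynomial (Fin n) K) →ₗ[MvPolynomial (Fin n) K] (ι → MvPolynomial (Fin n) K),
      IsHomMap deg' deg A ∧ ∀ v, f (A v) = g v := by
  choose w hw using fun a => h (Pi.single a 1)
  -- only the component of degree `deg' a` of a preimage of a basis element matters
  let z : κ → ι → MvPolynomial (Fin n) K := fun a c => part (deg' a - deg c) (w a c)
  have hz : ∀ a, f (z a) = g (Pi.single a 1) := by
    intro a
    funext b
    have h1 : part (deg' a - deg'' b) (f (w a) b) = g (Pi.single a 1) b := by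
      rw [hw, part_of_homogeneous (hg a b), if_pos rfl]
    rw [← h1, linearMap_apply_eq_sum, linearMap_apply_eq_sum f (w a), map_sum]
    refine Finset.sum_congr rfl fun c _ => ?_
    rw [part_mul (hf c b)]
    simp only [z]
    congr 2
    ring_nf
  refine ⟨Fintype.linearCombination (MvPolynomial (Fin n) K) z, ?_, ?_⟩
  · intro a c
    rw [Fintype.linearCombination_apply_single, one_smul]
    exact part_homogeneous _ _
  · intro v
    funext b
    rw [Fintype.linearCombination_apply, map_sum, Finset.sum_apply, linearMap_apply_eq_sum g]
    refine Finset.sum_congr rfl fun a _ => ?_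
    rw [map_smul, hz, Pi.smul_apply, smul_eq_mul]

/-- A graded form of Nakayama's lemma: the determinant of such an endomorphism is homogeneous of
degree `0`, hence a constant, and it is `1` modulo the variables. -/
theorem IsHomMap.bijective_of_sub_mem {deg : ι → ℤ}
    {T : (ι → MvPolynomial (Fin n) K) →ₗ[MvPolynomial (Fin n) K] (ι → MvPolynomial (Fin n) K)}
    (hT : IsHomMap deg deg T) (h : ∀ v b, (T v - v) b ∈ idealOfVars (Fin n) K) :
    Function.Bijective T := by
  let A := LinearMap.toMatrix' T
  have hA : ∀ b a, A b a = T (Pi.single a 1) b := by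
    intro b a
    simp [A, LinearMap.toMatrix'_apply]
  have hc : constantCoeff A.det = 1 := by
    rw [RingHom.map_det]
    have : (constantCoeff (σ := Fin n) (R := K)).mapMatrix A = 1 := by
      ext b a
      have h1 := constantCoeff_eq_zero_of_mem (h (Pi.single a 1) b)
      rw [Pi.sub_apply, map_sub, sub_eq_zero] at h1
      rw [RingHom.mapMatrix_apply, Matrix.map_apply, hA, h1, Pi.single_apply, Matrix.one_apply]
      split_ifs <;> simp
    rw [this, Matrix.det_one]
  have hh : IsHomogeneousOfDegree 0 A.det := by
    rw [Matrix.det_apply]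
    refine homogeneous_sum fun σ _ => ?_
    have h1 : IsHomogeneousOfDegree 0 (∏ a, A (σ a) a) := by
      have h2 : ∑ a, (deg a - deg (σ a)) = 0 := by
        rw [Finset.sum_sub_distrib, Equiv.sum_comp σ deg, sub_self]
      rw [← h2]
      refine homogeneous_prod fun a _ => ?_
      rw [hA]
      exact hT a (σ a)
    rcases Int.units_eq_one_or (Equiv.Perm.sign σ) with h2 | h2
    · rw [h2, one_smul]
      exact h1
    · rw [h2, Units.neg_smul, one_smul]
      exact homogeneous_neg h1
  have hdet : A.det = 1 := by
    ext e
    by_cases he : e = 0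
    · subst he
      simpa [constantCoeff_eq] using hc
    · rw [coeff_one, if_neg (Ne.symm he)]
      by_contra hne
      have := hh e (mem_support_iff.mpr hne)
      rw [Nat.cast_eq_zero, Finsupp.degree_eq_zero_iff] at this
      exact he this
  have hu : IsUnit (LinearMap.det T) := by
    rw [← LinearMap.det_toMatrix', hdet]
    exact isUnit_one
  exact (LinearEquiv.ofIsUnitDet (v := Pi.basisFun _ ι) (v' := Pi.basisFun _ ι) (f := T) (by
    rw [LinearMap.det_toMatrix]; exact hu)).bijective

/-- Minimal covers of the same graded module are isomorphic. -/
theorem IsHomMap.exists_equiv_of_minimal [Fintype κ] [DecidableEq κ]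
    {deg : ι → ℤ} {deg' : κ → ℤ} {deg'' : τ → ℤ}
    {f : (ι → MvPolynomial (Fin n) K) →ₗ[MvPolynomial (Fin n) K] (τ → MvPolynomial (Fin n) K)}
    {g : (κ → MvPolynomial (Fin n) K) →ₗ[MvPolynomial (Fin n) K] (τ → MvPolynomial (Fin n) K)}
    (hf : IsHomMap deg deg'' f) (hg : IsHomMap deg' deg'' g)
    (h : LinearMap.range f = LinearMap.range g)
    (hfmin : ∀ v ∈ LinearMap.ker f, ∀ a, v a ∈ idealOfVars (Fin n) K)
    (hgmin : ∀ v ∈ LinearMap.ker g, ∀ a, v a ∈ idealOfVars (Fin n) K) :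
    ∃ θ : (ι → MvPolynomial (Fin n) K) ≃ₗ[MvPolynomial (Fin n) K] (κ → MvPolynomial (Fin n) K),
      IsHomMap deg deg' θ.toLinearMap ∧ ∀ v, g (θ v) = f v := by
  obtain ⟨A, hA, hgA⟩ := hg.exists_lift hf fun v => h ▸ LinearMap.mem_range_self f v
  obtain ⟨B, hB, hfB⟩ := hf.exists_lift hg fun v => h ▸ LinearMap.mem_range_self g v
  have h1 : Function.Bijective (B ∘ₗ A) := by
    refine (hB.comp hA).bijective_of_sub_mem fun v => hfmin _ ?_
    rw [LinearMap.mem_ker, map_sub, LinearMap.comp_apply, hfB, hgA, sub_self]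
  have h2 : Function.Bijective (A ∘ₗ B) := by
    refine (hA.comp hB).bijective_of_sub_mem fun v => hgmin _ ?_
    rw [LinearMap.mem_ker, map_sub, LinearMap.comp_apply, hgA, hfB, sub_self]
  rw [LinearMap.coe_comp] at h1 h2
  exact ⟨LinearEquiv.ofBijective A ⟨h1.1.of_comp, h2.2.of_comp⟩, hA, hgA⟩

/-- The constant coefficients of the matrix of a graded isomorphism form an invertible matrix that
is block diagonal with respect to the degrees. -/
theorem IsHomMap.card_le [Fintype κ] [DecidableEq κ] {deg : ι → ℤ} {deg' : κ → ℤ}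
    {θ : (ι → MvPolynomial (Fin n) K) ≃ₗ[MvPolynomial (Fin n) K] (κ → MvPolynomial (Fin n) K)}
    (hθ : IsHomMap deg deg' θ.toLinearMap) (j : ℤ) :
    (Finset.univ.filter fun a => deg a = j).card ≤
      (Finset.univ.filter fun b => deg' b = j).card := by
  let A : Matrix κ ι K := Matrix.of fun b a => constantCoeff (θ (Pi.single a 1) b)
  let B : Matrix ι κ K := Matrix.of fun a b => constantCoeff (θ.symm (Pi.single b 1) a)
  have hBA : B * A = 1 := by
    ext a' a
    have h1 := linearMap_apply_eq_sum θ.symm.toLinearMap (θ (Pi.single a 1)) a'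
    simp only [LinearEquiv.coe_coe, LinearEquiv.symm_apply_apply] at h1
    have h2 := congrArg constantCoeff h1
    rw [map_sum] at h2
    rw [Matrix.mul_apply, Matrix.one_apply]
    simp only [A, B, Matrix.of_apply]
    rw [Finset.sum_congr rfl fun b _ => mul_comm _ _]
    simp only [map_mul] at h2
    rw [← h2, Pi.single_apply]
    split_ifs <;> simp
  have hA : ∀ b a, deg a ≠ deg' b → A b a = 0 := by
    intro b a hab
    simpa [A, constantCoeff_eq] using coeff_zero_of_homogeneous (sub_ne_zero.mpr hab) (hθ a b)
  let A' : Matrix {b // deg' b = j} {a // deg a = j} K := A.submatrix (↑) (↑)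
  let B' : Matrix {a // deg a = j} {b // deg' b = j} K := B.submatrix (↑) (↑)
  have hBA' : B' * A' = 1 := by
    ext a' a
    have h1 := congrFun (congrFun hBA a') a
    rw [Matrix.mul_apply, Matrix.one_apply] at h1
    rw [Matrix.mul_apply, Matrix.one_apply]
    simp only [A', B', Matrix.submatrix_apply]
    simp only [Subtype.ext_iff]
    rw [← h1, ← Finset.sum_subset (Finset.filter_subset (fun b => deg' b = j) Finset.univ)]
    · exact (Finset.sum_subtype (Finset.univ.filter fun b => deg' b = j) (by simp)
        fun b => B a' b * A b a).symm
    · intro b _ hb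
      rw [hA b a, mul_zero]
      rw [a.2]
      intro h
      exact hb (by simp [h])
  have hinj : Function.Injective A'.mulVecLin := by
    intro v w hvw
    have := congrArg B'.mulVec hvw
    simpa [Matrix.mulVec_mulVec, hBA'] using this
  have := LinearMap.finrank_le_finrank_of_injective hinj
  simpa [Fintype.card_subtype] using this

theorem map_ker_equiv {A M M' N : Type*} [CommRing A] [AddCommGroup M] [AddCommGroup M']
    [AddCommGroup N] [Module A M] [Module A M'] [Module A N] (θ : M ≃ₗ[A] M')
    {f : M →ₗ[A] N} {g : M' →ₗ[A] N} (h : ∀ v, g (θ v) = f v) :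
    (LinearMap.ker f).map θ.toLinearMap = LinearMap.ker g := by
  ext v
  constructor
  · rintro ⟨w, hw, rfl⟩
    exact (h w).trans hw
  · intro hv
    refine ⟨θ.symm v, ?_, θ.apply_symm_apply v⟩
    rw [SetLike.mem_coe, LinearMap.mem_ker, ← h, θ.apply_symm_apply]
    exact hv

end HomogeneousMaps

namespace MinimalGradedFreeResolution

variable {n : ℕ} {K : Type*} [Field K] {I : Ideal (MvPolynomial (Fin n) K)}

/-- Two minimal resolutions are isomorphic in each homological degree, by isomorphisms that carry
the syzygies of one to those of the other. The latter is what allows the induction on `i`. -/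
theorem exists_equiv (F G : MinimalGradedFreeResolution I) (i : ℕ) :
    ∃ θ : (Fin (F.rank i) → MvPolynomial (Fin n) K) ≃ₗ[MvPolynomial (Fin n) K]
        (Fin (G.rank i) → MvPolynomial (Fin n) K),
      IsHomMap (F.deg i) (G.deg i) θ.toLinearMap ∧
        (LinearMap.range (F.d i)).map θ.toLinearMap = LinearMap.range (G.d i) := by
  induction i with
  | zero =>
    -- the augmentation, with its target seen as a free module of rank one
    have key : ∀ H : MinimalGradedFreeResolution I,
        LinearMap.range (LinearMap.pi fun _ : Unit => H.aug) =
            Submodule.comap (LinearMap.proj (R := MvPolynomial (Fin n) K)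
              (φ := fun _ : Unit => MvPolynomial (Fin n) K) ()) I ∧
          LinearMap.ker (LinearMap.pi fun _ : Unit => H.aug) = LinearMap.range (H.d 0) := by
      intro H
      constructor
      · ext v
        have hv : v () ∈ LinearMap.range H.aug ↔ v () ∈ I := by rw [H.range_aug]
        rw [Submodule.mem_comap, LinearMap.proj_apply, ← hv]
        constructor
        · rintro ⟨w, rfl⟩
          exact ⟨w, rfl⟩
        · rintro ⟨w, hw⟩
          exact ⟨w, _root_.funext fun _ => hw⟩
      · rw [← H.ker_aug]
        ext v
        simp [_root_.funext_iff]
    obtain ⟨θ, h1, h2⟩ := IsHomMap.exists_equiv_of_minimal (deg := F.deg 0) (deg' := G.deg 0)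
      (deg'' := fun _ : Unit => 0)
      (f := LinearMap.pi fun _ => F.aug) (g := LinearMap.pi fun _ => G.aug)
      (fun a b => by simpa using F.aug_homogeneous a)
      (fun a b => by simpa using G.aug_homogeneous a)
      ((key F).1.trans (key G).1.symm)
      (by rw [(key F).2]; rintro _ ⟨v, rfl⟩ a; exact F.minimal 0 v a)
      (by rw [(key G).2]; rintro _ ⟨v, rfl⟩ a; exact G.minimal 0 v a)
    exact ⟨θ, h1, by rw [← (key F).2, ← (key G).2, map_ker_equiv θ h2]⟩
  | succ i ih =>
    obtain ⟨θ, hθ, hr⟩ := ih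
    have hk : LinearMap.ker (θ.toLinearMap ∘ₗ F.d i) = LinearMap.ker (F.d i) :=
      LinearMap.ker_comp_of_ker_eq_bot _ θ.ker
    obtain ⟨θ', h1, h2⟩ := IsHomMap.exists_equiv_of_minimal (f := θ.toLinearMap ∘ₗ F.d i)
      (g := G.d i) (hθ.comp (F.d_homogeneous i)) (G.d_homogeneous i)
      (by rw [LinearMap.range_comp, hr])
      (by
        rw [hk, F.ker_d]
        rintro _ ⟨v, rfl⟩ a
        exact F.minimal _ v a)
      (by
        rw [G.ker_d]
        rintro _ ⟨v, rfl⟩ a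
        exact G.minimal _ v a)
    refine ⟨θ', h1, ?_⟩
    rw [← F.ker_d, ← G.ker_d, ← hk, map_ker_equiv θ' h2]

theorem numGens_eq (F G : MinimalGradedFreeResolution I) (i : ℕ) (j : ℤ) :
    F.numGens i j = G.numGens i j := by
  obtain ⟨θ, hθ, -⟩ := F.exists_equiv G i
  obtain ⟨θ', hθ', -⟩ := G.exists_equiv F i
  exact le_antisymm (hθ.card_le j) (hθ'.card_le j)

theorem gradedBetti_eq (F : MinimalGradedFreeResolution I) (i : ℕ) (j : ℤ) :
    gradedBetti I i j = F.numGens i j := by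
  rw [gradedBetti, dif_pos ⟨F⟩, if_pos (Int.natCast_nonneg i), Int.toNat_natCast]
  exact numGens_eq _ F i j

end MinimalGradedFreeResolution

theorem gradedBetti_of_neg {n : ℕ} {K : Type*} [Field K] (I : Ideal (MvPolynomial (Fin n) K))
    {i : ℤ} (hi : i < 0) (j : ℤ) : gradedBetti I i j = 0 := by
  rw [gradedBetti]
  split_ifs <;> first | rfl | omega

/-! ### Minimal mapping cones -/

section Cone

variable {n : ℕ} {K : Type*} [Field K]

/-- A minimal graded free resolution may be indexed by arbitrary finite types. -/
theorem exists_resolution_of_fintype {I : Ideal (MvPolynomial (Fin n) K)} {ι : ℕ → Type*}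
    [∀ i, Fintype (ι i)] [∀ i, DecidableEq (ι i)] (deg : ∀ i, ι i → ℤ)
    (d : ∀ i, (ι (i + 1) → MvPolynomial (Fin n) K) →ₗ[MvPolynomial (Fin n) K]
      (ι i → MvPolynomial (Fin n) K))
    (aug : (ι 0 → MvPolynomial (Fin n) K) →ₗ[MvPolynomial (Fin n) K] MvPolynomial (Fin n) K)
    (hd : ∀ i, IsHomMap (deg (i + 1)) (deg i) (d i))
    (haug : ∀ a, IsHomogeneousOfDegree (deg 0 a) (aug (Pi.single a 1)))
    (hI : LinearMap.range aug = I) (h0 : LinearMap.ker aug = LinearMap.range (d 0))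
    (hex : ∀ i, LinearMap.ker (d i) = LinearMap.range (d (i + 1)))
    (hmin : ∀ i v b, d i v b ∈ idealOfVars (Fin n) K) :
    ∃ G : MinimalGradedFreeResolution I, ∀ i j,
      G.numGens i j = (Finset.univ.filter fun a => deg i a = j).card := by
  let σ : ∀ i, Fin (Fintype.card (ι i)) ≃ ι i := fun i => (Fintype.equivFin (ι i)).symm
  let ε : ∀ i, (ι i → MvPolynomial (Fin n) K) ≃ₗ[MvPolynomial (Fin n) K]
      (Fin (Fintype.card (ι i)) → MvPolynomial (Fin n) K) :=
    fun i => LinearEquiv.funCongrLeft _ _ (σ i)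
  have hε : ∀ i a, (ε i).symm (Pi.single a 1) = Pi.single (σ i a) 1 := by
    intro i a
    rw [LinearEquiv.symm_apply_eq]
    funext b
    simp [ε, LinearEquiv.funCongrLeft_apply, LinearMap.funLeft_apply, Pi.single_apply]
  refine ⟨{
    rank := fun i => Fintype.card (ι i)
    deg := fun i a => deg i (σ i a)
    d := fun i => (ε i).toLinearMap ∘ₗ d i ∘ₗ (ε (i + 1)).symm.toLinearMap
    aug := aug ∘ₗ (ε 0).symm.toLinearMap
    d_homogeneous := ?_
    aug_homogeneous := ?_
    range_aug := ?_
    ker_aug := ?_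
    ker_d := ?_
    minimal := ?_ }, ?_⟩
  · intro i a b
    simp only [LinearMap.comp_apply, LinearEquiv.coe_coe, hε]
    exact hd i (σ (i + 1) a) (σ i b)
  · intro a
    simp only [LinearMap.comp_apply, LinearEquiv.coe_coe, hε]
    exact haug _
  · rw [LinearMap.range_comp, LinearEquiv.range, Submodule.map_top, hI]
  · rw [LinearMap.range_comp, LinearMap.range_comp, LinearEquiv.range, Submodule.map_top, ← h0,
      LinearMap.ker_comp]
    exact (Submodule.map_equiv_eq_comap_symm _ _).symm
  · intro i
    rw [LinearMap.range_comp, LinearMap.range_comp, LinearEquiv.range, Submodule.map_top, ← hex,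
      LinearMap.ker_comp_of_ker_eq_bot _ (LinearEquiv.ker _), LinearMap.ker_comp]
    exact (Submodule.map_equiv_eq_comap_symm _ _).symm
  · intro i v b
    exact hmin i _ _
  · intro i j
    rw [MinimalGradedFreeResolution.numGens]
    exact Finset.card_equiv (σ i) (by simp)

/-- Dependent choice for sequences with terms in varying types. -/
theorem exists_seq_of_step {α : ℕ → Type*} (P : ∀ i, α i → Prop) (Q : ∀ i, α i → α (i + 1) → Prop)
    (a₀ : α 0) (h0 : P 0 a₀) (h : ∀ i a, P i a → ∃ b, P (i + 1) b ∧ Q i a b) :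
    ∃ f : ∀ i, α i, f 0 = a₀ ∧ ∀ i, P i (f i) ∧ Q i (f i) (f (i + 1)) := by
  choose g hg using h
  let s : ∀ i, {a : α i // P i a} := fun i =>
    Nat.rec ⟨a₀, h0⟩ (fun i a => ⟨g i a.1 a.2, (hg i a.1 a.2).1⟩) i
  exact ⟨fun i => (s i).1, rfl, fun i => ⟨(s i).2, (hg i (s i).1 (s i).2).2⟩⟩

/-- A graded linear map all of whose entries have nonzero degree has entries in the ideal of the
variables. -/
theorem IsHomMap.apply_mem_idealOfVars {ι κ : Type*} [Fintype ι] [DecidableEq ι] {deg : ι → ℤ}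
    {deg' : κ → ℤ}
    {f : (ι → MvPolynomial (Fin n) K) →ₗ[MvPolynomial (Fin n) K] (κ → MvPolynomial (Fin n) K)}
    (hf : IsHomMap deg deg' f) (h : ∀ a b, deg' b < deg a) (v : ι → MvPolynomial (Fin n) K)
    (b : κ) : f v b ∈ idealOfVars (Fin n) K := by
  rw [linearMap_apply_eq_sum]
  refine Ideal.sum_mem _ fun a _ => Ideal.mul_mem_left _ _ ?_
  refine mem_idealOfVars_of_constantCoeff (coeff_zero_of_homogeneous ?_ (hf a b))
  have := h a b
  omega

/-- Comparison maps from a shifted complex of free modules to a resolution of `I'`. For a sequence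
`⋯ → K_2 → K_1 → K_0 → R` in which `K_1` is mapped into `I'`, the negative of `K_1 → I'` lifts to a
family of maps `K_{i+1} → F_i` that anticommute with the differentials. -/
theorem exists_comparison {I' : Ideal (MvPolynomial (Fin n) K)}
    (F : MinimalGradedFreeResolution I') (r : ℕ → ℕ) (e : ∀ i, Fin (r i) → ℤ)
    (δ : ∀ i, (Fin (r (i + 1)) → MvPolynomial (Fin n) K) →ₗ[MvPolynomial (Fin n) K]
      (Fin (r i) → MvPolynomial (Fin n) K))
    (α : (Fin (r 0) → MvPolynomial (Fin n) K) →ₗ[MvPolynomial (Fin n) K] MvPolynomial (Fin n) K)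
    (hδ : ∀ i, IsHomMap (e (i + 1)) (e i) (δ i))
    (hα : ∀ a, IsHomogeneousOfDegree (e 0 a) (α (Pi.single a 1)))
    (hαδ : ∀ v, α (δ 0 v) ∈ I') (hδδ : ∀ i v, δ i (δ (i + 1) v) = 0) :
    ∃ φ : ∀ i, (Fin (r (i + 1)) → MvPolynomial (Fin n) K) →ₗ[MvPolynomial (Fin n) K]
        (Fin (F.rank i) → MvPolynomial (Fin n) K),
      (∀ i, IsHomMap (e (i + 1)) (F.deg i) (φ i)) ∧ (∀ v, F.aug (φ 0 v) = -α (δ 0 v)) ∧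
        ∀ i v, F.d i (φ (i + 1) v) = -φ i (δ (i + 1) v) := by
  have neg : ∀ {ι κ : Type} [DecidableEq ι] {deg : ι → ℤ} {deg' : κ → ℤ}
      {f : (ι → MvPolynomial (Fin n) K) →ₗ[MvPolynomial (Fin n) K] (κ → MvPolynomial (Fin n) K)},
      IsHomMap deg deg' f → IsHomMap deg deg' (-f) := fun hf a b => homogeneous_neg (hf a b)
  have haug : IsHomMap (F.deg 0) (fun _ : Unit => 0) (LinearMap.pi fun _ => F.aug) :=
    fun a b => by simpa using F.aug_homogeneous a
  have hα' : IsHomMap (e 0) (fun _ : Unit => 0) (LinearMap.pi fun _ => α) :=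
    fun a b => by simpa using hα a
  have mem : ∀ v, v ∈ I' ↔ ∃ w, F.aug w = v := fun v =>
    ⟨fun h => LinearMap.mem_range.mp (F.range_aug.symm ▸ h),
      fun ⟨w, hw⟩ => F.range_aug ▸ LinearMap.mem_range.mpr ⟨w, hw⟩⟩
  obtain ⟨φ₀, h1, h2⟩ := haug.exists_lift (neg (hα'.comp (hδ 0))) (by
    intro v
    obtain ⟨w, hw⟩ := (mem _).mp (hαδ v)
    refine ⟨-w, ?_⟩
    funext x
    simp [hw])
  have h2' : ∀ v, F.aug (φ₀ v) = -α (δ 0 v) := fun v => congrFun (h2 v) ()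
  obtain ⟨φ, hφ0, hφ⟩ := exists_seq_of_step
    (α := fun i => (Fin (r (i + 1)) → MvPolynomial (Fin n) K) →ₗ[MvPolynomial (Fin n) K]
        (Fin (F.rank i) → MvPolynomial (Fin n) K))
    (fun i φ => IsHomMap (e (i + 1)) (F.deg i) φ ∧
      ∀ v, φ (δ (i + 1) v) ∈ LinearMap.range (F.d i))
    (fun i φ ψ => ∀ v, F.d i (ψ v) = -φ (δ (i + 1) v)) φ₀
    ⟨h1, fun v => by
      rw [← F.ker_aug, LinearMap.mem_ker, h2', hδδ, map_zero, neg_zero]⟩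
    (by
      rintro i φ ⟨hφ, hr⟩
      obtain ⟨ψ, h3, h4⟩ := IsHomMap.exists_lift (F.d_homogeneous i)
        (neg (hφ.comp (hδ (i + 1)))) (fun v => neg_mem (hr v))
      refine ⟨ψ, ⟨h3, fun v => ?_⟩, h4⟩
      rw [← F.ker_d, LinearMap.mem_ker, h4]
      simp [hδδ])
  exact ⟨φ, fun i => (hφ i).1.1, fun v => by rw [hφ0, h2'], fun i => (hφ i).2⟩

/-- The mapping cone (or horseshoe) construction: a resolution `F` of `I'` and a resolution
`⋯ → K_1 → K_0` of `I / I'` give a resolution of `I` with terms `F_i ⊕ K_i`. It is minimal as soon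
as all basis elements of `K_{i+1}` have degrees larger than those of `F_i`. -/
theorem exists_resolution_cone {I I' : Ideal (MvPolynomial (Fin n) K)}
    (F : MinimalGradedFreeResolution I') (r : ℕ → ℕ) (e : ∀ i, Fin (r i) → ℤ)
    (δ : ∀ i, (Fin (r (i + 1)) → MvPolynomial (Fin n) K) →ₗ[MvPolynomial (Fin n) K]
      (Fin (r i) → MvPolynomial (Fin n) K))
    (α : (Fin (r 0) → MvPolynomial (Fin n) K) →ₗ[MvPolynomial (Fin n) K] MvPolynomial (Fin n) K)
    (hδ : ∀ i, IsHomMap (e (i + 1)) (e i) (δ i))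
    (hα : ∀ a, IsHomogeneousOfDegree (e 0 a) (α (Pi.single a 1)))
    (hI : I = I' ⊔ LinearMap.range α) (h0 : Submodule.comap α I' = LinearMap.range (δ 0))
    (hex : ∀ i, LinearMap.ker (δ i) = LinearMap.range (δ (i + 1)))
    (hmin : ∀ i v b, δ i v b ∈ idealOfVars (Fin n) K)
    (hdeg : ∀ i a b, F.deg i b < e (i + 1) a) :
    ∃ G : MinimalGradedFreeResolution I, ∀ i j,
      G.numGens i j = F.numGens i j + (Finset.univ.filter fun a => e i a = j).card := by
  have hδδ : ∀ i v, δ i (δ (i + 1) v) = 0 := fun i v => by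
    rw [← LinearMap.mem_ker, hex]
    exact ⟨v, rfl⟩
  have hαδ : ∀ v, α (δ 0 v) ∈ I' := fun v => by
    have : δ 0 v ∈ Submodule.comap α I' := h0 ▸ ⟨v, rfl⟩
    exact this
  obtain ⟨φ, hφ, hφ0, hφd⟩ := exists_comparison F r e δ α hδ hα hαδ hδδ
  let l : ∀ i, (Fin (F.rank i) ⊕ Fin (r i) → MvPolynomial (Fin n) K) →ₗ[MvPolynomial (Fin n) K]
      (Fin (F.rank i) → MvPolynomial (Fin n) K) := fun i => LinearMap.funLeft _ _ Sum.inl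
  let t : ∀ i, (Fin (F.rank i) ⊕ Fin (r i) → MvPolynomial (Fin n) K) →ₗ[MvPolynomial (Fin n) K]
      (Fin (r i) → MvPolynomial (Fin n) K) := fun i => LinearMap.funLeft _ _ Sum.inr
  have hl : ∀ i f k, l i (Sum.elim f k) = f := fun i f k => rfl
  have ht : ∀ i f k, t i (Sum.elim f k) = k := fun i f k => rfl
  have hlt : ∀ i v, Sum.elim (l i v) (t i v) = v := fun i v => Sum.elim_comp_inl_inr v
  have ll : ∀ i a, l i (Pi.single (Sum.inl a) 1) = Pi.single a 1 := by
    intro i a; funext b; simp [l, LinearMap.funLeft_apply, Pi.single_apply]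
  have lr : ∀ i a, l i (Pi.single (Sum.inr a) 1) = 0 := by
    intro i a; funext b; simp [l, LinearMap.funLeft_apply]
  have tl : ∀ i a, t i (Pi.single (Sum.inl a) 1) = 0 := by
    intro i a; funext b; simp [t, LinearMap.funLeft_apply]
  have tr : ∀ i a, t i (Pi.single (Sum.inr a) 1) = Pi.single a 1 := by
    intro i a; funext b; simp [t, LinearMap.funLeft_apply, Pi.single_apply]
  let d : ∀ i, (Fin (F.rank (i + 1)) ⊕ Fin (r (i + 1)) → MvPolynomial (Fin n) K)
      →ₗ[MvPolynomial (Fin n) K] (Fin (F.rank i) ⊕ Fin (r i) → MvPolynomial (Fin n) K) :=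
    fun i => (LinearEquiv.sumArrowLequivProdArrow _ _ _ _).symm.toLinearMap ∘ₗ
      LinearMap.prod (F.d i ∘ₗ l (i + 1) + φ i ∘ₗ t (i + 1)) (δ i ∘ₗ t (i + 1))
  have hd : ∀ i v, d i v =
      Sum.elim (F.d i (l (i + 1) v) + φ i (t (i + 1) v)) (δ i (t (i + 1) v)) := by
    intro i v
    funext b
    rcases b with b | b <;> rfl
  have hFd : ∀ i v, F.d i (F.d (i + 1) v) = 0 := fun i v => by
    rw [← LinearMap.mem_ker, F.ker_d]
    exact ⟨v, rfl⟩
  have hFaug : ∀ v, F.aug (F.d 0 v) = 0 := fun v => by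
    rw [← LinearMap.mem_ker, F.ker_aug]
    exact ⟨v, rfl⟩
  refine (exists_resolution_of_fintype (I := I)
    (ι := fun i => Fin (F.rank i) ⊕ Fin (r i)) (fun i => Sum.elim (F.deg i) (e i)) d
    (F.aug ∘ₗ l 0 + α ∘ₗ t 0) ?_ ?_ ?_ ?_ ?_ ?_).imp fun G hG i j => ?_
  rotate_right
  · rw [hG, MinimalGradedFreeResolution.numGens, Finset.card_filter, Fintype.sum_sum_type,
      Finset.card_filter, Finset.card_filter]
    rfl
  · rintro i (a | a) b
    · rw [hd, ll, tl, map_zero, map_zero, add_zero]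
      rcases b with b | b
      · exact F.d_homogeneous i a b
      · exact homogeneous_zero _
    · rw [hd, lr, tr, map_zero, zero_add]
      rcases b with b | b
      · exact hφ i a b
      · exact hδ i a b
  · rintro (a | a)
    · simpa [ll, tl] using F.aug_homogeneous a
    · simpa [lr, tr] using hα a
  · rw [hI]
    conv_rhs => rw [← F.range_aug]
    ext p
    rw [Submodule.mem_sup]
    constructor
    · rintro ⟨v, rfl⟩
      exact ⟨_, ⟨l 0 v, rfl⟩, _, ⟨t 0 v, rfl⟩, rfl⟩
    · rintro ⟨_, ⟨f, rfl⟩, _, ⟨k, rfl⟩, rfl⟩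
      exact ⟨Sum.elim f k, rfl⟩
  · ext v
    rw [LinearMap.mem_ker]
    simp only [LinearMap.add_apply, LinearMap.comp_apply]
    constructor
    · intro hv
      have h1 : t 0 v ∈ Submodule.comap α I' := by
        rw [Submodule.mem_comap, ← neg_mem_iff, ← eq_neg_of_add_eq_zero_left hv]
        exact F.range_aug.le ⟨l 0 v, rfl⟩
      rw [h0] at h1
      obtain ⟨k, hk⟩ := h1
      have h2 : l 0 v - φ 0 k ∈ LinearMap.ker F.aug := by
        rw [LinearMap.mem_ker, map_sub, hφ0, hk, sub_neg_eq_add, hv]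
      rw [F.ker_aug] at h2
      obtain ⟨w, hw⟩ := h2
      refine ⟨Sum.elim w k, ?_⟩
      rw [hd, hl, ht, hw, hk, sub_add_cancel, hlt]
    · rintro ⟨w, rfl⟩
      rw [hd, hl, ht, map_add, hFaug, hφ0]
      simp
  · intro i
    ext v
    rw [LinearMap.mem_ker]
    constructor
    · intro hv
      rw [hd] at hv
      have hv1 := congrArg (l i) hv
      have hv2 := congrArg (t i) hv
      rw [hl, map_zero] at hv1
      rw [ht, map_zero] at hv2
      rw [← LinearMap.mem_ker, hex] at hv2
      obtain ⟨k, hk⟩ := hv2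
      have h2 : l (i + 1) v - φ (i + 1) k ∈ LinearMap.ker (F.d i) := by
        rw [LinearMap.mem_ker, map_sub, hφd, hk, sub_neg_eq_add, hv1]
      rw [F.ker_d] at h2
      obtain ⟨w, hw⟩ := h2
      refine ⟨Sum.elim w k, ?_⟩
      rw [hd, hl, ht, hw, hk, sub_add_cancel, hlt]
    · rintro ⟨w, rfl⟩
      rw [hd, hd, hl, ht, map_add, hFd, hφd, hδδ]
      funext b
      rcases b with b | b <;> simp
  · intro i v b
    rw [hd]
    rcases b with b | b
    · exact Ideal.add_mem _ (F.minimal i _ b) ((hφ i).apply_mem_idealOfVars (hdeg i) _ b)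
    · exact hmin i _ b

/-- Adding a form `p` of degree `δ` to an ideal `I'`: the quotient `(I' + (p)) / I'` is
`R / (I' : p)`, shifted by `δ`. -/
theorem exists_resolution_sup_span_singleton {I' L : Ideal (MvPolynomial (Fin n) K)}
    (F : MinimalGradedFreeResolution I') (H : MinimalGradedFreeResolution L)
    {p : MvPolynomial (Fin n) K} {δ : ℤ} (hp : IsHomogeneousOfDegree δ p)
    (hL : ∀ q, q ∈ L ↔ q * p ∈ I') (hLv : L ≤ idealOfVars (Fin n) K)
    (hdeg : ∀ i a b, F.deg i b < H.deg i a + δ) :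
    ∃ G : MinimalGradedFreeResolution (I' ⊔ Ideal.span {p}),
      (∀ j, G.numGens 0 j = F.numGens 0 j + if j = δ then 1 else 0) ∧
        ∀ i j, G.numGens (i + 1) j = F.numGens (i + 1) j + H.numGens i (j - δ) := by
  refine (exists_resolution_cone (I := I' ⊔ Ideal.span {p}) F
    -- the resolution of `R / L` obtained from `H` by putting `R` in homological degree `0`
    (fun i => Nat.casesOn i 1 H.rank)
    (fun i => Nat.casesOn (motive := fun i => Fin (Nat.casesOn i 1 H.rank) → ℤ) i (fun _ => δ)
      (fun i a => H.deg i a + δ))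
    (fun i => Nat.casesOn (motive := fun i =>
      (Fin (Nat.casesOn (i + 1) 1 H.rank) → MvPolynomial (Fin n) K) →ₗ[MvPolynomial (Fin n) K]
        (Fin (Nat.casesOn i 1 H.rank) → MvPolynomial (Fin n) K)) i
      (LinearMap.pi fun _ => H.aug) H.d)
    (LinearMap.mulRight _ p ∘ₗ LinearMap.proj (0 : Fin 1)) ?_ ?_ ?_ ?_ ?_ ?_ ?_).imp fun G hG => ?_
  rotate_right
  · refine ⟨fun j => ?_, fun i j => ?_⟩
    · rw [hG]
      congr 1
      by_cases h : j = δ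
      · simp [h]
      · simp [h, Ne.symm h]
    · rw [hG]
      congr 1
      rw [MinimalGradedFreeResolution.numGens]
      congr 1
      ext a
      simp only [Finset.mem_filter, Finset.mem_univ, true_and]
      exact eq_sub_iff_add_eq.symm
  · rintro (_ | i) a b
    · have := H.aug_homogeneous a
      simpa using this
    · have := H.d_homogeneous i a b
      simpa using this
  · intro a
    have : a = 0 := Subsingleton.elim (α := Fin 1) _ _
    subst this
    simpa using hp
  · congr 1
    ext q
    rw [Ideal.mem_span_singleton', LinearMap.mem_range]
    constructor
    · rintro ⟨a, rfl⟩
      exact ⟨fun _ => a, rfl⟩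
    · rintro ⟨v, rfl⟩
      exact ⟨v 0, rfl⟩
  · ext v
    have h1 : v 0 ∈ LinearMap.range H.aug ↔ v 0 * p ∈ I' := by
      rw [← hL]
      exact SetLike.ext_iff.mp H.range_aug _
    refine h1.symm.trans ⟨?_, ?_⟩
    · rintro ⟨w, hw⟩
      refine ⟨w, _root_.funext fun b => ?_⟩
      rw [Subsingleton.elim (α := Fin 1) b 0]
      exact hw
    · rintro ⟨w, rfl⟩
      exact ⟨w, rfl⟩
  · rintro (_ | i)
    · refine Eq.trans ?_ H.ker_aug
      ext v
      simp [_root_.funext_iff]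
    · exact H.ker_d i
  · rintro (_ | i) v b
    · exact hLv (H.range_aug.le ⟨v, rfl⟩)
    · exact H.minimal i v b
  · intro i a b
    exact hdeg i a b

end Cone

/-! ### Betti numbers of ideals with linear quotients -/

section LinearQuotients

variable {n : ℕ} {K : Type*} [Field K]

theorem exists_resolution_bot :
    ∃ F : MinimalGradedFreeResolution (⊥ : Ideal (MvPolynomial (Fin n) K)),
      ∀ i j, F.numGens i j = 0 := by
  refine ⟨{
    rank := fun _ => 0
    deg := fun _ a => a.elim0
    d := fun _ => 0
    aug := 0
    d_homogeneous := fun _ a => a.elim0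
    aug_homogeneous := fun a => a.elim0
    range_aug := LinearMap.range_zero
    ker_aug := Subsingleton.elim _ _
    ker_d := fun _ => Subsingleton.elim _ _
    minimal := fun _ _ b => b.elim0 }, fun i j => ?_⟩
  simp [MinimalGradedFreeResolution.numGens]

/-- The Betti numbers of an ideal generated by variables; the resolution is the Koszul complex,
obtained by adding one variable at a time. -/
theorem exists_resolution_span_X (S : Finset (Fin n)) :
    ∃ H : MinimalGradedFreeResolution
        (Ideal.span ((X : Fin n → MvPolynomial (Fin n) K) '' (S : Set (Fin n)))),
      ∀ i j, H.numGens i j = if j = (i : ℤ) + 1 then S.card.choose (i + 1) else 0 := by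
  classical
  induction S using Finset.induction_on with
  | empty =>
    rw [Finset.coe_empty, Set.image_empty, Ideal.span_empty]
    obtain ⟨F, hF⟩ := exists_resolution_bot (n := n) (K := K)
    exact ⟨F, fun i j => by simp [hF]⟩
  | insert l S hl ih =>
    obtain ⟨F, hF⟩ := ih
    have hdeg : ∀ i a, F.deg i a = (i : ℤ) + 1 := by
      intro i a
      by_contra h
      have h1 := hF i (F.deg i a)
      rw [if_neg h, MinimalGradedFreeResolution.numGens, Finset.card_eq_zero] at h1
      exact Finset.notMem_empty a (h1 ▸ by simp)
    have hX : IsHomogeneousOfDegree 1 (X l : MvPolynomial (Fin n) K) := by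
      have := homogeneous_monomial (Finsupp.single l 1) (1 : K)
      simpa [X] using this
    obtain ⟨G, h0, hs⟩ := exists_resolution_sup_span_singleton F F hX (by
        intro q
        rw [mem_ideal_span_X_image, mem_ideal_span_X_image, support_mul_X]
        simp only [Finset.mem_map, addRightEmbedding_apply, forall_exists_index, and_imp,
          forall_apply_eq_imp_iff₂]
        refine forall₂_congr fun e _ => exists_congr fun x => and_congr_right fun hx => ?_
        have : l ≠ x := fun h => hl (h ▸ hx)
        simp [this])
      (Ideal.span_mono (Set.image_subset_range _ _))
      (by intro i a b; rw [hdeg, hdeg]; omega)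
    rw [Finset.coe_insert, Set.image_insert_eq, Ideal.span_insert, sup_comm]
    refine ⟨G, fun i j => ?_⟩
    rw [Finset.card_insert_of_notMem hl]
    cases i with
    | zero =>
      rw [h0, hF]
      simp only [Nat.cast_zero, zero_add, Nat.choose_one_right]
      split_ifs <;> rfl
    | succ i =>
      rw [hs, hF, hF, Nat.choose_succ_succ' _ (i + 1)]
      push_cast
      by_cases h : j = (i : ℤ) + 1 + 1
      · rw [if_pos h, if_pos (by omega), if_pos h, add_comm]
      · rw [if_neg h, if_neg (by omega), if_neg h]

/-- The monomials in `G`, ordered by the function `r`, have linear quotients: for each `M ∈ G`, the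
ideal of the preceding monomials has the colon ideal `(x_l : l ∈ S M)` with respect to `M`. The
monomials in `G` are also required not to divide each other. -/
structure HasLinearQuotients {α : Type*} [LinearOrder α] (G : Finset (Fin n →₀ ℕ))
    (S : (Fin n →₀ ℕ) → Finset (Fin n)) (r : (Fin n →₀ ℕ) → α) : Prop where
  antichain : ∀ M ∈ G, ∀ N ∈ G, M ≤ N → M = N
  injOn : ∀ M ∈ G, ∀ N ∈ G, r M = r N → M = N
  exists_lt : ∀ M ∈ G, ∀ N ∈ G, r N < r M → ∃ l ∈ S M, M l < N l
  exists_tsub_eq : ∀ M ∈ G, ∀ l ∈ S M, ∃ N ∈ G, r N < r M ∧ N - M = Finsupp.single l 1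

theorem apply_eq_of_tsub_eq_single {M N : Fin n →₀ ℕ} {l : Fin n}
    (h : N - M = Finsupp.single l 1) : N l = M l + 1 ∧ ∀ x, x ≠ l → N x ≤ M x := by
  have h1 : ∀ x, N x - M x = Finsupp.single l 1 x := fun x => by
    rw [← h, Finsupp.tsub_apply]
  refine ⟨?_, fun x hx => ?_⟩
  · have := h1 l
    rw [Finsupp.single_eq_same] at this
    omega
  · have := h1 x
    rw [Finsupp.single_eq_of_ne hx] at this
    omega

/-- If `N : M = x_l`, then `N` is `x_l` times a proper divisor of `M`. -/
theorem HasLinearQuotients.degree_le {α : Type*} [LinearOrder α]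
    {G : Finset (Fin n →₀ ℕ)} {S : (Fin n →₀ ℕ) → Finset (Fin n)} {r : (Fin n →₀ ℕ) → α}
    (h : HasLinearQuotients G S r) {M N : Fin n →₀ ℕ} (hM : M ∈ G) (hN : N ∈ G) (hr : r N < r M)
    {l : Fin n} (htsub : N - M = Finsupp.single l 1) : N.degree ≤ M.degree := by
  have hle : N ≤ M + Finsupp.single l 1 := by
    rw [add_comm, ← tsub_le_iff_right, htsub]
  obtain ⟨P, hP⟩ := le_iff_exists_add.mp hle
  have hne : P ≠ 0 := by
    rintro rfl
    rw [add_zero] at hP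
    have := h.antichain M hM N hN (hP ▸ le_self_add)
    rw [this] at hr
    exact lt_irrefl _ hr
  have hdeg := congrArg Finsupp.degree hP
  rw [map_add, map_add, Finsupp.degree_single] at hdeg
  have := (Finsupp.degree_eq_zero_iff P).not.mpr hne
  omega

/-- The colon condition also holds against later monomials of smaller degree. -/
theorem HasLinearQuotients.exists_lt_of_degree_lt {α : Type*} [LinearOrder α]
    {G : Finset (Fin n →₀ ℕ)} {S : (Fin n →₀ ℕ) → Finset (Fin n)} {r : (Fin n →₀ ℕ) → α}
    (h : HasLinearQuotients G S r) {M N : Fin n →₀ ℕ} (hM : M ∈ G) (hN : N ∈ G)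
    (hd : N.degree < M.degree) : ∃ l ∈ S M, M l < N l := by
  by_contra hno
  -- a counterexample `N` that comes first in the order
  obtain ⟨N, hmem, hmin⟩ := Finset.exists_min_image
    (G.filter fun N => N.degree < M.degree ∧ ¬ ∃ l ∈ S M, M l < N l) r
    ⟨N, Finset.mem_filter.mpr ⟨hN, hd, hno⟩⟩
  obtain ⟨hN, hd, hno⟩ := Finset.mem_filter.mp hmem
  rcases lt_trichotomy (r N) (r M) with hlt | heq | hgt
  · exact hno (h.exists_lt M hM N hN hlt)
  · rw [h.injOn N hN M hM heq] at hd
    exact lt_irrefl _ hd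
  · obtain ⟨l, hl, hlM⟩ := h.exists_lt N hN M hM hgt
    obtain ⟨N', hN', hr, htsub⟩ := h.exists_tsub_eq N hN l hl
    obtain ⟨h1, h2⟩ := apply_eq_of_tsub_eq_single htsub
    have hdeg := h.degree_le hN hN' hr htsub
    have hN'M : ∃ t ∈ S M, M t < N' t := by
      by_contra hno'
      exact absurd (hmin N' (Finset.mem_filter.mpr ⟨hN', by omega, hno'⟩)) (not_le.mpr hr)
    obtain ⟨t, ht, htM⟩ := hN'M
    have htl : t ≠ l := by
      rintro rfl
      omega
    exact hno ⟨t, ht, htM.trans_le (h2 t htl)⟩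

/-- An order with linear quotients can be refined to one by increasing degrees, with the same
colon ideals. -/
theorem HasLinearQuotients.sort {α : Type*} [LinearOrder α]
    {G : Finset (Fin n →₀ ℕ)} {S : (Fin n →₀ ℕ) → Finset (Fin n)} {r : (Fin n →₀ ℕ) → α}
    (h : HasLinearQuotients G S r) :
    HasLinearQuotients G S fun M => toLex (M.degree, r M) where
  antichain := h.antichain
  injOn M hM N hN heq := h.injOn M hM N hN (Prod.ext_iff.mp (toLex.injective heq)).2
  exists_lt M hM N hN hlt := by
    rcases Prod.Lex.toLex_lt_toLex.mp hlt with hd | ⟨-, hr⟩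
    · exact h.exists_lt_of_degree_lt hM hN hd
    · exact h.exists_lt M hM N hN hr
  exists_tsub_eq M hM l hl := by
    obtain ⟨N, hN, hr, htsub⟩ := h.exists_tsub_eq M hM l hl
    refine ⟨N, hN, Prod.Lex.toLex_lt_toLex.mpr ?_, htsub⟩
    rcases (h.degree_le hM hN hr htsub).lt_or_eq with h1 | h1
    exacts [Or.inl h1, Or.inr ⟨h1, hr⟩]

theorem HasLinearQuotients.of_insert {α : Type*} [LinearOrder α]
    {G : Finset (Fin n →₀ ℕ)} {S : (Fin n →₀ ℕ) → Finset (Fin n)} {r : (Fin n →₀ ℕ) → α}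
    {M : Fin n →₀ ℕ} (h : HasLinearQuotients (insert M G) S r) (hM : ∀ N ∈ G, r N ≤ r M) :
    HasLinearQuotients G S r where
  antichain A hA B hB := h.antichain A (Finset.mem_insert_of_mem hA) B (Finset.mem_insert_of_mem hB)
  injOn A hA B hB := h.injOn A (Finset.mem_insert_of_mem hA) B (Finset.mem_insert_of_mem hB)
  exists_lt A hA B hB := h.exists_lt A (Finset.mem_insert_of_mem hA) B (Finset.mem_insert_of_mem hB)
  exists_tsub_eq A hA l hl := by
    obtain ⟨N, hN, hr, htsub⟩ := h.exists_tsub_eq A (Finset.mem_insert_of_mem hA) l hl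
    refine ⟨N, Finset.mem_of_mem_insert_of_ne hN ?_, hr, htsub⟩
    rintro rfl
    exact absurd hr (not_lt.mpr (hM A hA))

/-- If `N : M` lies in `(x_l : l ∈ S)` for all `N ∈ G` and each of these variables generates some
`N : M`, then the colon ideal of `(G)` with respect to `M` is `(x_l : l ∈ S)`. -/
theorem mul_monomial_mem_span_iff {G : Set (Fin n →₀ ℕ)} {M : Fin n →₀ ℕ} {S : Finset (Fin n)}
    (h1 : ∀ N ∈ G, ∃ l ∈ S, M l < N l)
    (h2 : ∀ l ∈ S, ∃ N ∈ G, N - M = Finsupp.single l 1) (q : MvPolynomial (Fin n) K) :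
    q ∈ Ideal.span ((X : Fin n → MvPolynomial (Fin n) K) '' (S : Set (Fin n))) ↔
      q * monomial M 1 ∈ Ideal.span ((fun a => monomial a (1 : K)) '' G) := by
  rw [mem_ideal_span_X_image, mem_ideal_span_monomial_image]
  constructor
  · intro h e he
    rw [mem_support_iff, coeff_mul_monomial'] at he
    split_ifs at he with hMe
    · obtain ⟨l, hl, hle⟩ := h (e - M) (by simpa using he)
      obtain ⟨N, hN, htsub⟩ := h2 l hl
      refine ⟨N, hN, ?_⟩
      obtain ⟨h3, h4⟩ := apply_eq_of_tsub_eq_single htsub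
      intro x
      by_cases hx : x = l
      · subst hx
        rw [Finsupp.tsub_apply] at hle
        omega
      · exact (h4 x hx).trans (hMe x)
    · exact absurd rfl he
  · intro h e he
    obtain ⟨N, hN, hle⟩ := h (e + M) (by simpa [mem_support_iff, coeff_mul_monomial] using he)
    obtain ⟨l, hl, hlt⟩ := h1 N hN
    have := hle l
    rw [Finsupp.add_apply] at this
    exact ⟨l, hl, by omega⟩

/-- The Betti numbers of an ideal with linear quotients, for an order by increasing degrees: in
this case the mapping cones are minimal. -/
theorem HasLinearQuotients.exists_resolution_of_monotone {α : Type*} [LinearOrder α]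
    {G : Finset (Fin n →₀ ℕ)} {S : (Fin n →₀ ℕ) → Finset (Fin n)} {r : (Fin n →₀ ℕ) → α}
    (h : HasLinearQuotients G S r) (hr : ∀ M ∈ G, ∀ N ∈ G, r M ≤ r N → M.degree ≤ N.degree) :
    ∃ F : MinimalGradedFreeResolution
        (Ideal.span ((fun a => monomial a (1 : K)) '' (G : Set (Fin n →₀ ℕ)))),
      ∀ i j, F.numGens i j =
        ∑ M ∈ G, if (M.degree : ℤ) + i = j then (S M).card.choose i else 0 := by
  classical
  induction G using Finset.induction_on_max_value r with
  | empty =>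
    rw [Finset.coe_empty, Set.image_empty, Ideal.span_empty]
    obtain ⟨F, hF⟩ := exists_resolution_bot (n := n) (K := K)
    exact ⟨F, fun i j => by simp [hF]⟩
  | insert M G hMG hmax ih =>
    obtain ⟨F, hF⟩ := ih (h.of_insert hmax) fun A hA B hB =>
      hr A (Finset.mem_insert_of_mem hA) B (Finset.mem_insert_of_mem hB)
    obtain ⟨H, hH⟩ := exists_resolution_span_X (K := K) (S M)
    have hM := Finset.mem_insert_self M G
    have hlt : ∀ N ∈ G, r N < r M := fun N hN =>
      lt_of_le_of_ne (hmax N hN) fun heq =>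
        hMG (h.injOn N (Finset.mem_insert_of_mem hN) M hM heq ▸ hN)
    have hFdeg : ∀ i a, F.deg i a ≤ (M.degree : ℤ) + i := by
      intro i a
      by_contra hcon
      have h1 := hF i (F.deg i a)
      rw [Finset.sum_eq_zero, MinimalGradedFreeResolution.numGens, Finset.card_eq_zero] at h1
      · exact Finset.notMem_empty a (h1 ▸ by simp)
      · intro N hN
        have := hr N (Finset.mem_insert_of_mem hN) M hM (hmax N hN)
        rw [if_neg (by omega)]
    have hHdeg : ∀ i a, H.deg i a = (i : ℤ) + 1 := by
      intro i a
      by_contra hcon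
      have h1 := hH i (H.deg i a)
      rw [if_neg hcon, MinimalGradedFreeResolution.numGens, Finset.card_eq_zero] at h1
      exact Finset.notMem_empty a (h1 ▸ by simp)
    obtain ⟨F', h0, hs⟩ := exists_resolution_sup_span_singleton F H (homogeneous_monomial M (1 : K))
      (mul_monomial_mem_span_iff
        (fun N hN => h.exists_lt M hM N (Finset.mem_insert_of_mem hN) (hlt N hN))
        (fun l hl => by
          obtain ⟨N, hN, hrN, htsub⟩ := h.exists_tsub_eq M hM l hl
          refine ⟨N, Finset.mem_of_mem_insert_of_ne hN ?_, htsub⟩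
          rintro rfl
          exact lt_irrefl _ hrN))
      (Ideal.span_mono (Set.image_subset_range _ _))
      (by
        intro i a b
        rw [hHdeg]
        have := hFdeg i b
        omega)
    rw [Finset.coe_insert, Set.image_insert_eq, Ideal.span_insert, sup_comm]
    refine ⟨F', fun i j => ?_⟩
    rw [Finset.sum_insert hMG, add_comm]
    cases i with
    | zero =>
      rw [h0, hF]
      simp [eq_comm]
    | succ i =>
      rw [hs, hF, hH]
      congr 1
      refine if_congr ?_ rfl rfl
      push_cast
      omega

/-- The Betti numbers of an ideal with linear quotients; no condition on the degrees is needed. -/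
theorem HasLinearQuotients.gradedBetti_eq {α : Type*} [LinearOrder α]
    {G : Finset (Fin n →₀ ℕ)} {S : (Fin n →₀ ℕ) → Finset (Fin n)} {r : (Fin n →₀ ℕ) → α}
    (h : HasLinearQuotients G S r) (i : ℕ) (j : ℤ) :
    gradedBetti (Ideal.span ((fun a => monomial a (1 : K)) '' (G : Set (Fin n →₀ ℕ)))) i j =
      ∑ M ∈ G, if (M.degree : ℤ) + i = j then (S M).card.choose i else 0 := by
  obtain ⟨F, hF⟩ := h.sort.exists_resolution_of_monotone (K := K) fun M _ N _ hle => by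
    rcases Prod.Lex.toLex_le_toLex.mp hle with h1 | h1
    exacts [h1.le, h1.1.le]
  rw [F.gradedBetti_eq, hF]

end LinearQuotients

/-! ### Decomposable ideals have linear quotients -/

section Shedding

variable {n : ℕ} {K : Type*} [Field K]

theorem minGens_antichain {I : Ideal (MvPolynomial (Fin n) K)} {M N : Fin n →₀ ℕ}
    (hM : M ∈ minGens I) (hN : N ∈ minGens I) (h : M ≤ N) : M = N :=
  le_antisymm h (hN.2 hM.1 h)

theorem minGens_span {A : Set (Fin n →₀ ℕ)} (hA : ∀ M ∈ A, ∀ N ∈ A, M ≤ N → M = N) :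
    minGens (Ideal.span ((fun a => monomial a (1 : K)) '' A)) = A := by
  have hmem : ∀ a, monomial a (1 : K) ∈ Ideal.span ((fun a => monomial a (1 : K)) '' A) ↔
      ∃ b ∈ A, b ≤ a := by
    intro a
    rw [mem_ideal_span_monomial_image]
    simp
  ext M
  constructor
  · rintro ⟨h1, h2⟩
    obtain ⟨N, hN, hle⟩ := (hmem M).mp h1
    rwa [le_antisymm (h2 ((hmem N).mpr ⟨N, hN, le_rfl⟩) hle) hle]
  · intro hM
    refine ⟨(hmem M).mpr ⟨M, hM, le_rfl⟩, fun N hN hle => ?_⟩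
    obtain ⟨P, hP, hPN⟩ := (hmem N).mp hN
    rwa [← hA P hP M hM (hPN.trans hle)]

theorem minGens_upperPart (I : Ideal (MvPolynomial (Fin n) K)) (u : Fin n →₀ ℕ) :
    minGens (upperPart I u) = {M | M ∈ minGens I ∧ ¬ BracketEqOne u M} :=
  minGens_span fun _ hM _ hN => minGens_antichain hM.1 hN.1

theorem minGens_lowerPart (I : Ideal (MvPolynomial (Fin n) K)) (u : Fin n →₀ ℕ) :
    minGens (lowerPart I u) = {M | M ∈ minGens I ∧ BracketEqOne u M} :=
  minGens_span fun _ hM _ hN => minGens_antichain hM.1 hN.1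

theorem minGens_upperPart_union_lowerPart (I : Ideal (MvPolynomial (Fin n) K)) (u : Fin n →₀ ℕ) :
    minGens (upperPart I u) ∪ minGens (lowerPart I u) = minGens I := by
  ext M
  rw [minGens_upperPart, minGens_lowerPart]
  constructor
  · rintro (h | h) <;> exact h.1
  · intro h
    by_cases hb : BracketEqOne u M
    exacts [Or.inr ⟨h, hb⟩, Or.inl ⟨h, hb⟩]

theorem not_bracketEqOne_of_mem_minGens_upperPart {I : Ideal (MvPolynomial (Fin n) K)}
    {u M : Fin n →₀ ℕ} (h : M ∈ minGens (upperPart I u)) : ¬ BracketEqOne u M := by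
  rw [minGens_upperPart] at h
  exact h.2

theorem bracketEqOne_of_mem_minGens_lowerPart {I : Ideal (MvPolynomial (Fin n) K)}
    {u M : Fin n →₀ ℕ} (h : M ∈ minGens (lowerPart I u)) : BracketEqOne u M := by
  rw [minGens_lowerPart] at h
  exact h.2

theorem IsMonomialIdeal.span_minGens {I : Ideal (MvPolynomial (Fin n) K)}
    (hI : IsMonomialIdeal I) : Ideal.span ((fun a => monomial a (1 : K)) '' minGens I) = I := by
  apply le_antisymm
  · rw [Ideal.span_le]
    rintro _ ⟨M, hM, rfl⟩
    exact hM.1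
  · obtain ⟨s, hs⟩ := hI
    conv_lhs => rw [hs]
    rw [Ideal.span_le]
    rintro _ ⟨a, ha, rfl⟩
    have haI : monomial a (1 : K) ∈ I := hs ▸ Ideal.subset_span ⟨a, ha, rfl⟩
    obtain ⟨M, hle, hM⟩ :=
      exists_minimal_le_of_wellFoundedLT (fun b => monomial b (1 : K) ∈ I) a haI
    rw [SetLike.mem_coe, mem_ideal_span_monomial_image]
    intro e he
    have := support_monomial_subset he
    rw [Finset.mem_singleton] at this
    exact ⟨M, hM, this ▸ hle⟩

/-- The generator `N` with `N : M = x_l` must have `x_l`-exponent at least that of `u`, as its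
other exponents do not exceed those of `M`. -/
theorem apply_add_one_eq_of_shedding {u M N : Fin n →₀ ℕ} (hM : BracketEqOne u M)
    (hN : ¬ BracketEqOne u N) {l : Fin n} (hl : l ∈ u.support)
    (h : N - M = Finsupp.single l 1) : M l + 1 = u l := by
  obtain ⟨h1, h2⟩ := apply_eq_of_tsub_eq_single h
  simp only [BracketEqOne, not_forall, not_not] at hN
  obtain ⟨x, hx, hxN⟩ := hN
  have hMx := hM x hx
  have hxl : x = l := by
    by_contra hne
    have := h2 x hne
    omega
  subst hxl
  omega

/-- The generators of `I_u` all have exponent `u_l - 1` at each `x_l` in the support of `u`, so that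
none of these variables occurs in the colon ideals of `I_u`. -/
theorem HasLinearQuotients.disjoint_support {α : Type*} [LinearOrder α] {G : Finset (Fin n →₀ ℕ)}
    {S : (Fin n →₀ ℕ) → Finset (Fin n)} {r : (Fin n →₀ ℕ) → α} (h : HasLinearQuotients G S r)
    {u : Fin n →₀ ℕ} (hu : ∀ M ∈ G, ∀ l ∈ u.support, M l + 1 = u l) {M : Fin n →₀ ℕ} (hM : M ∈ G) :
    Disjoint (S M) u.support := by
  rw [Finset.disjoint_left]
  intro l hl hlu
  obtain ⟨N, hN, -, htsub⟩ := h.exists_tsub_eq M hM l hl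
  have h1 := (apply_eq_of_tsub_eq_single htsub).1
  have h2 := hu M hM l hlu
  have h3 := hu N hN l hlu
  omega

open Classical in
/-- Linear quotients of `I^u` and of `I_u` combine to linear quotients of `I`; the colon ideals of
the generators of `I_u` grow by the variables in the support of `u`. -/
theorem HasLinearQuotients.union {G₁ G₂ : Finset (Fin n →₀ ℕ)}
    {S₁ S₂ : (Fin n →₀ ℕ) → Finset (Fin n)} {r₁ r₂ : (Fin n →₀ ℕ) → ℕ} {u : Fin n →₀ ℕ}
    (h₁ : HasLinearQuotients G₁ S₁ r₁) (h₂ : HasLinearQuotients G₂ S₂ r₂)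
    (hanti : ∀ M ∈ G₁ ∪ G₂, ∀ N ∈ G₁ ∪ G₂, M ≤ N → M = N)
    (hu₁ : ∀ N ∈ G₁, ¬ BracketEqOne u N) (hu₂ : ∀ M ∈ G₂, BracketEqOne u M)
    (hs : ∀ M ∈ G₂, ∀ l ∈ u.support, ∃ N ∈ G₁, N - M = Finsupp.single l 1) :
    ∃ r : (Fin n →₀ ℕ) → ℕ, HasLinearQuotients (G₁ ∪ G₂)
      (fun M => if BracketEqOne u M then S₂ M ∪ u.support else S₁ M) r := by
  have hlt : ∀ N ∈ G₁, r₁ N < G₁.sup r₁ + 1 := fun N hN => Nat.lt_succ_of_le (Finset.le_sup hN)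
  -- the shift of `r₂` places all of `G₂` after `G₁`
  refine ⟨fun M => if BracketEqOne u M then G₁.sup r₁ + 1 + r₂ M else r₁ M, hanti, ?_, ?_, ?_⟩
  · intro M hM N hN heq
    rcases Finset.mem_union.mp hM with hM | hM <;> rcases Finset.mem_union.mp hN with hN | hN
    · simp only [hu₁ M hM, hu₁ N hN, if_false] at heq
      exact h₁.injOn M hM N hN heq
    · simp only [hu₁ M hM, hu₂ N hN, if_false, if_true] at heq
      have := hlt M hM
      omega
    · simp only [hu₂ M hM, hu₁ N hN, if_false, if_true] at heq
      have := hlt N hN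
      omega
    · simp only [hu₂ M hM, hu₂ N hN, if_true] at heq
      exact h₂.injOn M hM N hN (by omega)
  · intro M hM N hN hr
    rcases Finset.mem_union.mp hM with hM | hM <;> rcases Finset.mem_union.mp hN with hN | hN
    · simp only [hu₁ M hM, hu₁ N hN, if_false] at hr ⊢
      exact h₁.exists_lt M hM N hN hr
    · simp only [hu₁ M hM, hu₂ N hN, if_false, if_true] at hr
      have := hlt M hM
      omega
    · have hN' := hu₁ N hN
      simp only [BracketEqOne, not_forall, not_not] at hN'
      obtain ⟨l, hl, hle⟩ := hN'
      have := hu₂ M hM l hl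
      simp only [hu₂ M hM, if_true]
      exact ⟨l, Finset.mem_union_right _ hl, by omega⟩
    · simp only [hu₂ M hM, hu₂ N hN, if_true] at hr ⊢
      obtain ⟨l, hl, h⟩ := h₂.exists_lt M hM N hN (by omega)
      exact ⟨l, Finset.mem_union_left _ hl, h⟩
  · intro M hM l hl
    rcases Finset.mem_union.mp hM with hM | hM
    · simp only [hu₁ M hM, if_false] at hl ⊢
      obtain ⟨N, hN, hr, htsub⟩ := h₁.exists_tsub_eq M hM l hl
      refine ⟨N, Finset.mem_union_left _ hN, ?_, htsub⟩
      simpa only [hu₁ N hN, if_false] using hr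
    · simp only [hu₂ M hM, if_true] at hl ⊢
      rcases Finset.mem_union.mp hl with hl | hl
      · obtain ⟨N, hN, hr, htsub⟩ := h₂.exists_tsub_eq M hM l hl
        refine ⟨N, Finset.mem_union_right _ hN, ?_, htsub⟩
        simp only [hu₂ N hN, if_true]
        omega
      · obtain ⟨N, hN, htsub⟩ := hs M hM l hl
        refine ⟨N, Finset.mem_union_left _ hN, ?_, htsub⟩
        simp only [hu₁ N hN, if_false]
        have := hlt N hN
        omega

open Classical in
theorem IsSheddingMonomial.exists_hasLinearQuotients {I : Ideal (MvPolynomial (Fin n) K)}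
    {u : Fin n →₀ ℕ} (hu : IsSheddingMonomial I u) {G₁ G₂ : Finset (Fin n →₀ ℕ)}
    (hG₁ : (G₁ : Set (Fin n →₀ ℕ)) = minGens (upperPart I u))
    (hG₂ : (G₂ : Set (Fin n →₀ ℕ)) = minGens (lowerPart I u))
    {S₁ S₂ : (Fin n →₀ ℕ) → Finset (Fin n)} {r₁ r₂ : (Fin n →₀ ℕ) → ℕ}
    (h₁ : HasLinearQuotients G₁ S₁ r₁) (h₂ : HasLinearQuotients G₂ S₂ r₂) :
    ∃ r : (Fin n →₀ ℕ) → ℕ, HasLinearQuotients (G₁ ∪ G₂)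
      (fun M => if BracketEqOne u M then S₂ M ∪ u.support else S₁ M) r := by
  have hG : ((G₁ ∪ G₂ : Finset (Fin n →₀ ℕ)) : Set (Fin n →₀ ℕ)) = minGens I := by
    rw [Finset.coe_union, hG₁, hG₂, minGens_upperPart_union_lowerPart]
  have hmem : ∀ M, M ∈ G₁ ∪ G₂ → M ∈ minGens I := fun M hM => hG ▸ Finset.mem_coe.mpr hM
  refine h₁.union h₂ (fun M hM N hN => minGens_antichain (hmem M hM) (hmem N hN))
    (fun N hN => not_bracketEqOne_of_mem_minGens_upperPart (hG₁ ▸ Finset.mem_coe.mpr hN))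
    (fun M hM => bracketEqOne_of_mem_minGens_lowerPart (hG₂ ▸ Finset.mem_coe.mpr hM)) ?_
  intro M hM l hl
  obtain ⟨N, hN, h⟩ := hu.2 M (hG₂ ▸ Finset.mem_coe.mpr hM) l hl
  exact ⟨N, Finset.mem_coe.mp (hG₁ ▸ hN), h⟩

/-- Decomposable monomial ideals have linear quotients. -/
theorem IsKDecomposable.exists_hasLinearQuotients {k : ℤ} {I : Ideal (MvPolynomial (Fin n) K)}
    (h : IsKDecomposable k I) :
    ∃ (G : Finset (Fin n →₀ ℕ)) (S : (Fin n →₀ ℕ) → Finset (Fin n)) (r : (Fin n →₀ ℕ) → ℕ),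
      (G : Set (Fin n →₀ ℕ)) = minGens I ∧ HasLinearQuotients G S r := by
  classical
  induction h with
  | principal I hI h =>
    obtain ⟨M, hM⟩ := h
    refine ⟨{M}, fun _ => ∅, fun _ => 0, by simp [hM], ?_, ?_, ?_, ?_⟩ <;> simp
  | shedding I hI u hu hk hlow hup ihlow ihup =>
    obtain ⟨G₂, S₂, r₂, hG₂, h₂⟩ := ihlow
    obtain ⟨G₁, S₁, r₁, hG₁, h₁⟩ := ihup
    obtain ⟨r, hr⟩ := hu.exists_hasLinearQuotients hG₁ hG₂ h₁ h₂
    refine ⟨_, _, r, ?_, hr⟩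
    rw [Finset.coe_union, hG₁, hG₂, minGens_upperPart_union_lowerPart]

/-- Vandermonde's identity, with the sum running over all `l ≤ m`, also those greater than `i`. -/
theorem sum_range_choose_mul_choose (m s i : ℕ) :
    (∑ l ∈ Finset.range (m + 1), m.choose l * if l ≤ i then s.choose (i - l) else 0) =
      (s + m).choose i := by
  rw [add_comm s m, Nat.add_choose_eq, Finset.Nat.sum_antidiagonal_eq_sum_range_succ_mk]
  simp only [mul_ite, mul_zero]
  rw [← Finset.sum_filter]
  refine Finset.sum_subset_zero_on_sdiff ?_ ?_ fun _ _ => rfl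
  · intro l hl
    simp only [Finset.mem_filter, Finset.mem_range] at hl ⊢
    omega
  · intro l hl
    simp only [Finset.mem_sdiff, Finset.mem_filter, Finset.mem_range] at hl
    rw [Nat.choose_eq_zero_of_lt (by omega), zero_mul]

theorem IsMonomialIdeal.gradedBetti_eq {α : Type*} [LinearOrder α]
    {I : Ideal (MvPolynomial (Fin n) K)} (hI : IsMonomialIdeal I) {G : Finset (Fin n →₀ ℕ)}
    (hG : (G : Set (Fin n →₀ ℕ)) = minGens I) {S : (Fin n →₀ ℕ) → Finset (Fin n)}
    {r : (Fin n →₀ ℕ) → α} (h : HasLinearQuotients G S r) (i : ℕ) (j : ℤ) :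
    gradedBetti I i j =
      ∑ M ∈ G, if (M.degree : ℤ) + i = j then (S M).card.choose i else 0 := by
  rw [← h.gradedBetti_eq (K := K), hG, hI.span_minGens]

theorem IsKDecomposableWith.gradedBetti_eq {k : ℤ} {I : Ideal (MvPolynomial (Fin n) K)}
    {u : Fin n →₀ ℕ} (h : IsKDecomposableWith k I u) (i j : ℤ) :
    gradedBetti I i j = gradedBetti (upperPart I u) i j +
      ∑ l ∈ Finset.range (u.support.card + 1),
        u.support.card.choose l * gradedBetti (lowerPart I u) (i - l) (j - l) := by
  classical
  obtain ⟨hI, hu, -, hlow, hup⟩ := h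
  rcases lt_or_ge i 0 with hi | hi
  · have h0 : ∀ l ∈ Finset.range (u.support.card + 1),
        u.support.card.choose l * gradedBetti (lowerPart I u) (i - l) (j - l) = 0 := fun l _ => by
      rw [gradedBetti_of_neg _ (by omega), mul_zero]
    rw [gradedBetti_of_neg _ hi, gradedBetti_of_neg _ hi, Finset.sum_eq_zero h0,
      add_zero]
  lift i to ℕ using hi
  obtain ⟨G₁, S₁, r₁, hG₁, h₁⟩ := hup.exists_hasLinearQuotients
  obtain ⟨G₂, S₂, r₂, hG₂, h₂⟩ := hlow.exists_hasLinearQuotients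
  obtain ⟨r, hr⟩ := hu.exists_hasLinearQuotients hG₁ hG₂ h₁ h₂
  have hb₁ : ∀ N ∈ G₁, ¬ BracketEqOne u N := fun N hN =>
    not_bracketEqOne_of_mem_minGens_upperPart (hG₁ ▸ Finset.mem_coe.mpr hN)
  have hb₂ : ∀ M ∈ G₂, BracketEqOne u M := fun M hM =>
    bracketEqOne_of_mem_minGens_lowerPart (hG₂ ▸ Finset.mem_coe.mpr hM)
  have hdisj : Disjoint G₁ G₂ := Finset.disjoint_left.mpr fun M h1 h2 => hb₁ M h1 (hb₂ M h2)
  have hexp : ∀ M ∈ G₂, ∀ l ∈ u.support, M l + 1 = u l := by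
    intro M hM l hl
    obtain ⟨N, hN, h⟩ := hu.2 M (hG₂ ▸ Finset.mem_coe.mpr hM) l hl
    exact apply_add_one_eq_of_shedding (hb₂ M hM)
      (hb₁ N (Finset.mem_coe.mp (hG₁ ▸ hN))) hl h
  have hG : ((G₁ ∪ G₂ : Finset (Fin n →₀ ℕ)) : Set (Fin n →₀ ℕ)) = minGens I := by
    rw [Finset.coe_union, hG₁, hG₂, minGens_upperPart_union_lowerPart]
  have hIup : IsMonomialIdeal (upperPart I u) := ⟨_, rfl⟩
  have hIlow : IsMonomialIdeal (lowerPart I u) := ⟨_, rfl⟩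
  rw [hI.gradedBetti_eq hG hr, hIup.gradedBetti_eq hG₁ h₁, Finset.sum_union hdisj]
  congr 1
  · refine Finset.sum_congr rfl fun N hN => ?_
    rw [if_neg (hb₁ N hN)]
  have hβ : ∀ l : ℕ, gradedBetti (lowerPart I u) (i - l) (j - l) =
      ∑ M ∈ G₂, if (M.degree : ℤ) + i = j then
        (if l ≤ i then (S₂ M).card.choose (i - l) else 0) else 0 := by
    intro l
    by_cases hl : l ≤ i
    · rw [show (i : ℤ) - l = ((i - l : ℕ) : ℤ) by omega, hIlow.gradedBetti_eq hG₂ h₂]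
      refine Finset.sum_congr rfl fun M _ => ?_
      rw [if_pos hl]
      exact if_congr (by omega) rfl rfl
    · rw [gradedBetti_of_neg _ (by omega)]
      simp [hl]
  simp only [hβ, Finset.mul_sum]
  rw [Finset.sum_comm]
  refine Finset.sum_congr rfl fun M hM => ?_
  rw [if_pos (hb₂ M hM), Finset.card_union_of_disjoint (h₂.disjoint_support hexp hM),
    ← sum_range_choose_mul_choose]
  split_ifs <;> simp

end Shedding

end DecomposableIdeal

theorem theorem2p4 {n : ℕ} {K : Type*} [Field K] (k : ℤ)
    (I : Ideal (MvPolynomial (Fin n) K)) (u : Fin n →₀ ℕ)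
    (h : DecomposableIdeal.IsKDecomposableWith k I u) (i j : ℤ) :
    DecomposableIdeal.gradedBetti I i j =
      DecomposableIdeal.gradedBetti (DecomposableIdeal.upperPart I u) i j +
        ∑ l ∈ Finset.range (u.support.card + 1),
          u.support.card.choose l *
            DecomposableIdeal.gradedBetti (DecomposableIdeal.lowerPart I u) (i - l) (j - l) :=
  h.gradedBetti_eq i j
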